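/- Let $\Omega\subset\mathbb{C}$ be a domain (a nonempty connected open set). Let $\widehat{\Omega}$ be the simply connected envelope of $\Omega$, i.e. the intersection of all simply connected domains $G$ with $\Omega\subset G\subset\mathbb{C}$, and let $X$ be the connected component of $\infty$ in $(\mathbb{C}\cup\{\infty\})\setminus\Omega$. Then $\widehat{\Omega}=X^c:=(\mathbb{C}\cup\{\infty\})\setminus X$, and this set is itself a simply connected domain in $\mathbb{C}$ containing $\Omega$ (hence the least one). Moreover, for every holomorphic function $f$ on $\Omega$ the following are equivalent. (1) $f$ has one-valued primitives of every order on $\Omega$: for every $n=1,2,\dots$ there is a holomorphic function $\varphi_n$ on $\Omega$ with $\varphi_n^{(n)}=f$ on $\Omega$. (2) $\int_\gamma P(z)f(z)\,dz=0$ for every closed polygonal line $\gamma$ in $\Omega$ and every complex polynomial $P$. (3) $f$ has a holomorphic extension to $\widehat{\Omega}$; equivalently, $f$ has a holomorphic extension to $X^c$. -/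

import Mathlib

open Set

/-- A domain in the complex plane: a nonempty connected open set. -/
def IsComplexDomain (Ω : Set ℂ) : Prop := IsOpen Ω ∧ IsConnected Ω

/-- A simply connected domain in the complex plane. -/
def IsSimplyConnectedDomain (G : Set ℂ) : Prop := IsOpen G ∧ IsSimplyConnected G

/-- The simply connected envelope of `Ω`: the intersection of all simply connected domains of the
plane that contain `Ω`. -/
def simplyConnectedEnvelope (Ω : Set ℂ) : Set ℂ :=
  ⋂₀ {G : Set ℂ | IsSimplyConnectedDomain G ∧ Ω ⊆ G}

/-- The connected component of `∞` in the complement of `Ω` in the Riemann sphere `ℂ ∪ {∞}`. -/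
def componentOfInfinity (Ω : Set ℂ) : Set (OnePoint ℂ) :=
  connectedComponentIn (((↑) : ℂ → OnePoint ℂ) '' Ω)ᶜ OnePoint.infty

/-- The complement in the Riemann sphere of the component of `∞`, as a subset of the plane
(it never contains `∞`, so nothing is lost). -/
def complComponentOfInfinity (Ω : Set ℂ) : Set ℂ :=
  ((↑) : ℂ → OnePoint ℂ) ⁻¹' (componentOfInfinity Ω)ᶜ

/-- A closed polygonal line in `Ω`: finitely many straight sides, each contained in `Ω` and each
starting where the previous one ends, the last one ending where the first one starts.
Self-intersections and degenerate sides are allowed. -/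
structure ClosedPolygonalLine (Ω : Set ℂ) where
  /-- the number of sides -/
  numSides : ℕ
  numSides_pos : 0 < numSides
  /-- the consecutive vertices -/
  vertex : Fin (numSides + 1) → ℂ
  closed : vertex (Fin.last numSides) = vertex 0
  side_subset : ∀ i : Fin numSides, segment ℝ (vertex i.castSucc) (vertex i.succ) ⊆ Ω

/-- The complex line integral of `g` along the straight segment from `a` to `b`. -/
noncomputable def segmentIntegral (g : ℂ → ℂ) (a b : ℂ) : ℂ :=
  ∫ t in (0 : ℝ)..1, g (AffineMap.lineMap a b t) * (b - a)

/-- The complex line integral of `g` along a closed polygonal line. -/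
noncomputable def ClosedPolygonalLine.integral {Ω : Set ℂ} (γ : ClosedPolygonalLine Ω)
    (g : ℂ → ℂ) : ℂ :=
  ∑ i : Fin γ.numSides, segmentIntegral g (γ.vertex i.castSucc) (γ.vertex i.succ)

/-- `f` has one-valued holomorphic primitives of every order `n ≥ 1` on the open set `Ω`. -/
def HasPrimitivesOfEveryOrder (f : ℂ → ℂ) (Ω : Set ℂ) : Prop :=
  ∀ n : ℕ, 1 ≤ n → ∃ φ : ℂ → ℂ, DifferentiableOn ℂ φ Ω ∧ ∀ z ∈ Ω, iteratedDeriv n φ z = f z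

/-- The restriction of `f` to `Ω` has a holomorphic extension to `W`. -/
def HasHolomorphicExtension (f : ℂ → ℂ) (Ω W : Set ℂ) : Prop :=
  ∃ F : ℂ → ℂ, DifferentiableOn ℂ F W ∧ ∀ z ∈ Ω, F z = f z

/-! ### Bounded pieces of the complement -/

/-! The link between topology and analysis is the compact piece: a compact part `A` of `Ωᶜ` that is
open and closed in `Ωᶜ`. In the compact Hausdorff space `(ℂ ∪ {∞}) \ Ω` components are intersections
of clopen sets, so `X^c` is the union of the sets `Ω ∪ A`. Each of these is open and connected, and
`X^c` itself has no nonempty compact piece.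

Absence of pieces is used through one statement (`IsLocalCocycle.exists_potential_on_compact`): if
an open set has no nonempty compact piece, a group-valued function of two points that is
multiplicative inside discs has a potential near the diagonal of any compact subset. On a fine grid,
a cluster of squares near the complement that could not be reached from outside would isolate a
compact piece; hence these squares can be filled in one by one, changing one edge value each time.
With values in the fundamental group this gives simple connectivity of `X^c`; with values in the
additive group of `ℂ` it gives primitives of all holomorphic functions there, hence (3) → (1).

(1) → (2) is repeated integration by parts. For (2) → (3), every `P f` has a primitive. Let `χ` be a
cutoff equal to `1` near a piece `A`, and let `v` be the Cauchy transform solving `∂̄v = f ∂̄χ`. The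
moments of `f ∂̄χ` vanish, so `v` vanishes near infinity. Then `f χ - v` is holomorphic off `A` and
zero near infinity, hence zero on the connected set `Aᶜ`. So near `A` the function `v` continues
`f`; the extensions over all pieces agree and glue.

Minimality of `X^c` follows from the same extension theorem: if `G ⊇ Ω` is simply connected and `z ∉
G`, a logarithm of `w - z` on `G` makes all `P(w)/(w - z)` exact on `Ω`. So `1/(w - z)` would extend
to `X^c`, which is impossible if `z ∈ X^c`. -/

theorem isPreconnected_union_of_compl_eq {α : Type*} [TopologicalSpace α] [PreconnectedSpace α]
    {Ω A B : Set α} (hΩ : IsPreconnected Ω) (hne : Ω.Nonempty) (hA : IsClosed A) (hB : IsClosed B)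
    (hAB : Disjoint A B) (h : A ∪ B = Ωᶜ) : IsPreconnected (Ω ∪ A) := by
  have hopen : IsOpen (Ω ∪ A) := by
    have : Ω ∪ A = Bᶜ := by
      ext x
      have h1 : x ∈ A ∪ B ↔ x ∈ Ωᶜ := by rw [h]
      have h2 : x ∈ A → x ∉ B := fun ha hb => hAB.le_bot ⟨ha, hb⟩
      simp only [mem_union, mem_compl_iff] at h1 ⊢
      tauto
    rw [this]
    exact hB.isOpen_compl
  have key : ∀ u v : Set α, IsOpen u → IsOpen v → Ω ∪ A ⊆ u ∪ v → (Ω ∪ A) ∩ (u ∩ v) = ∅ →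
      Ω ⊆ u → Ω ∪ A ⊆ u := by
    intro u v hu hv huv hdisj hΩu
    -- With `Ω` on the side of `u`, the other side lies in `A` and is closed in the whole space; it
    -- is also open, because `Ω ∪ A = Bᶜ`.
    have hQ : (Ω ∪ A) ∩ v = A ∩ uᶜ := by
      ext x
      have h1 : x ∉ (Ω ∪ A) ∩ (u ∩ v) := by rw [hdisj]; exact notMem_empty x
      have h2 := @huv x
      have h3 := @hΩu x
      simp only [mem_union, mem_compl_iff, mem_inter_iff] at h1 h2 ⊢
      tauto
    have hclopen : IsClopen ((Ω ∪ A) ∩ v) :=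
      ⟨hQ ▸ hA.inter hu.isClosed_compl, hopen.inter hv⟩
    rcases isClopen_iff.1 hclopen with h0 | h0
    · intro x hx
      rcases huv hx with hxu | hxv
      · exact hxu
      · exact absurd (show x ∈ (Ω ∪ A) ∩ v from ⟨hx, hxv⟩) (by rw [h0]; exact notMem_empty x)
    · obtain ⟨x, hx⟩ := hne
      have : x ∈ (Ω ∪ A) ∩ v := by rw [h0]; trivial
      rw [hQ] at this
      exact absurd (hΩu hx) this.2
  rw [isPreconnected_iff_subset_of_disjoint]
  intro u v hu hv huv hdisj
  rcases isPreconnected_iff_subset_of_disjoint.1 hΩ u v hu hv (subset_union_left.trans huv)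
    (subset_empty_iff.1 (hdisj ▸ inter_subset_inter_left _ subset_union_left)) with h1 | h1
  · exact Or.inl (key u v hu hv huv hdisj h1)
  · exact Or.inr (key v u hv hu (union_comm u v ▸ huv) (inter_comm u v ▸ hdisj) h1)

/-- A compact part of the complement of `Ω` which is open and closed in the complement. -/
structure IsCompactPiece {α : Type*} [TopologicalSpace α] (Ω A : Set α) : Prop where
  isCompact : IsCompact A
  subset_compl : A ⊆ Ωᶜ
  isClosed_diff : IsClosed (Ωᶜ \ A)

namespace IsCompactPiece

variable {α : Type*} [TopologicalSpace α] {Ω A A' : Set α}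

theorem isOpen_union (hA : IsCompactPiece Ω A) : IsOpen (Ω ∪ A) := by
  have h : Ω ∪ A = (Ωᶜ \ A)ᶜ := by
    ext x
    simp only [mem_union, mem_compl_iff, mem_sdiff]
    tauto
  exact h ▸ hA.isClosed_diff.isOpen_compl

theorem inter [T2Space α] (hA : IsCompactPiece Ω A) (hA' : IsCompactPiece Ω A') :
    IsCompactPiece Ω (A ∩ A') where
  isCompact := hA.isCompact.inter hA'.isCompact
  subset_compl := inter_subset_left.trans hA.subset_compl
  isClosed_diff := by
    rw [sdiff_inter]
    exact hA.isClosed_diff.union hA'.isClosed_diff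

theorem isPreconnected_union [T2Space α] [PreconnectedSpace α] (hA : IsCompactPiece Ω A)
    (hΩ : IsConnected Ω) : IsPreconnected (Ω ∪ A) :=
  isPreconnected_union_of_compl_eq hΩ.isPreconnected hΩ.nonempty hA.isCompact.isClosed
    hA.isClosed_diff disjoint_sdiff_right (union_sdiff_cancel hA.subset_compl)

theorem isPreconnected_compl [T2Space α] [PreconnectedSpace α] (hA : IsCompactPiece Ω A)
    (hΩ : IsConnected Ω) : IsPreconnected Aᶜ := by
  have h := isPreconnected_union_of_compl_eq hΩ.isPreconnected hΩ.nonempty hA.isClosed_diff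
    hA.isCompact.isClosed disjoint_sdiff_left (sdiff_union_of_subset hA.subset_compl)
  have h2 : Ω ∪ (Ωᶜ \ A) = Aᶜ := by
    ext x
    have := @hA.subset_compl x
    simp only [mem_union, mem_compl_iff, mem_sdiff] at this ⊢
    tauto
  rwa [h2] at h

end IsCompactPiece

/-- On the sphere, `A` and the complement of `Ω ∪ A` are disjoint closed sets covering `X`, and `∞`
lies in the second. `X` is kept general so that the lemma serves both for `Ω` and for the envelope
in place of `Ω`. -/
theorem coe_notMem_of_isPreconnected_of_isCompactPiece {X : Set (OnePoint ℂ)}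
    (hX : IsPreconnected X) (hinf : OnePoint.infty ∈ X) {Ω A : Set ℂ}
    (hsub : ∀ z : ℂ, (z : OnePoint ℂ) ∈ X → z ∉ Ω) (hA : IsCompactPiece Ω A) {z : ℂ}
    (hz : z ∈ A) : (z : OnePoint ℂ) ∉ X := by
  intro hzX
  set u : Set (OnePoint ℂ) := ((↑) : ℂ → OnePoint ℂ) '' A
  set v : Set (OnePoint ℂ) := (((↑) : ℂ → OnePoint ℂ) '' (Ω ∪ A))ᶜ
  have hu : IsClosed u := OnePoint.isClosed_image_coe.2 ⟨hA.isCompact.isClosed, hA.isCompact⟩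
  have hv : IsClosed v :=
    (OnePoint.isOpenEmbedding_coe.isOpenMap _ hA.isOpen_union).isClosed_compl
  have huv : u ∩ v = ∅ := by
    ext x
    simp only [mem_inter_iff, mem_empty_iff_false, iff_false, not_and]
    rintro ⟨y, hy, rfl⟩ h
    exact h ⟨y, Or.inr hy, rfl⟩
  have hcov : X ⊆ u ∪ v := by
    intro x hx
    induction x using OnePoint.rec with
    | infty => exact Or.inr (by rintro ⟨y, -, hy⟩; exact OnePoint.coe_ne_infty y hy)
    | coe y =>
      by_cases hy : y ∈ A
      · exact Or.inl ⟨y, hy, rfl⟩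
      · right
        rintro ⟨w, hw, hwy⟩
        rw [OnePoint.coe_eq_coe] at hwy
        subst hwy
        exact hw.elim (hsub w hx) hy
  rcases isPreconnected_iff_subset_of_disjoint_closed.1 hX u v hu hv hcov
    (by rw [huv, inter_empty]) with h | h
  · obtain ⟨y, -, hy⟩ := h hinf
    exact OnePoint.coe_ne_infty y hy
  · exact h hzX ⟨z, Or.inr hz, rfl⟩

theorem infty_mem_compl_image_coe (Ω : Set ℂ) :
    OnePoint.infty ∈ (((↑) : ℂ → OnePoint ℂ) '' Ω)ᶜ := by
  rintro ⟨y, -, hy⟩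
  exact OnePoint.coe_ne_infty y hy

theorem infty_mem_componentOfInfinity (Ω : Set ℂ) : OnePoint.infty ∈ componentOfInfinity Ω :=
  mem_connectedComponentIn (infty_mem_compl_image_coe Ω)

theorem notMem_of_coe_mem_componentOfInfinity {Ω : Set ℂ} {z : ℂ}
    (hz : (z : OnePoint ℂ) ∈ componentOfInfinity Ω) : z ∉ Ω :=
  fun h => connectedComponentIn_subset _ _ hz ⟨z, h, rfl⟩

theorem mem_complComponentOfInfinity_iff {Ω : Set ℂ} (hΩ : IsOpen Ω) {z : ℂ} :
    z ∈ complComponentOfInfinity Ω ↔ z ∈ Ω ∨ ∃ A, IsCompactPiece Ω A ∧ z ∈ A := by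
  constructor
  · intro hz
    by_cases hzΩ : z ∈ Ω
    · exact Or.inl hzΩ
    right
    set K : Set (OnePoint ℂ) := (((↑) : ℂ → OnePoint ℂ) '' Ω)ᶜ with hK
    have hKcl : IsClosed K := (OnePoint.isOpenEmbedding_coe.isOpenMap _ hΩ).isClosed_compl
    have : CompactSpace K := isCompact_iff_compactSpace.1 hKcl.isCompact
    have hzK : (z : OnePoint ℂ) ∈ K := by
      rintro ⟨w, hw, hwz⟩
      rw [OnePoint.coe_eq_coe] at hwz
      exact hzΩ (hwz ▸ hw)
    have hinf := infty_mem_compl_image_coe Ω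
    have hz' : (⟨z, hzK⟩ : K) ∉ connectedComponent (⟨OnePoint.infty, hinf⟩ : K) := by
      intro h
      refine hz ?_
      rw [componentOfInfinity, connectedComponentIn_eq_image hinf]
      exact ⟨_, h, rfl⟩
    -- Component equals quasicomponent in a compact Hausdorff space: some clopen `s` contains `∞`
    -- but not `z`, and `sᶜ` is the required piece.
    rw [connectedComponent_eq_iInter_isClopen] at hz'
    simp only [mem_iInter, not_forall] at hz'
    obtain ⟨⟨s, hs, hinfs⟩, hzs⟩ := hz'
    have himg : ∀ t : Set K, IsClosed t → IsClosed ((↑) '' t : Set (OnePoint ℂ)) := fun t ht =>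
      (ht.isCompact.image continuous_subtype_val).isClosed
    have h1 := himg sᶜ hs.compl.1
    have h2 := himg s hs.1
    have hni : OnePoint.infty ∉ ((↑) '' sᶜ : Set (OnePoint ℂ)) := by
      rintro ⟨y, hy, hyi⟩
      exact hy ((show y = ⟨OnePoint.infty, hinf⟩ from Subtype.ext hyi) ▸ hinfs)
    refine ⟨((↑) : ℂ → OnePoint ℂ) ⁻¹' ((↑) '' sᶜ), ⟨?_, ?_, ?_⟩, ?_⟩
    · exact ((OnePoint.isClosed_iff_of_notMem hni).1 h1).2
    · rintro w ⟨y, -, hy⟩ hw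
      exact y.2 (hy ▸ ⟨w, hw, rfl⟩)
    · convert h2.preimage OnePoint.continuous_coe using 1
      ext w
      constructor
      · rintro ⟨hw, hw2⟩
        have hwK : (w : OnePoint ℂ) ∈ K := by
          rintro ⟨x, hx, hxw⟩
          rw [OnePoint.coe_eq_coe] at hxw
          exact hw (hxw ▸ hx)
        by_contra h
        refine hw2 ⟨⟨w, hwK⟩, fun hws => h ⟨_, hws, rfl⟩, rfl⟩
      · rintro ⟨y, hy, hyw⟩
        refine ⟨fun hw => y.2 (hyw ▸ ⟨w, hw, rfl⟩), ?_⟩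
        rintro ⟨y', hy', hyw'⟩
        exact hy' ((show y' = y from Subtype.ext (hyw'.trans hyw.symm)) ▸ hy)
    · exact ⟨⟨z, hzK⟩, hzs, rfl⟩
  · rintro (hz | ⟨A, hA, hz⟩) hX
    · exact notMem_of_coe_mem_componentOfInfinity hX hz
    · exact coe_notMem_of_isPreconnected_of_isCompactPiece isPreconnected_connectedComponentIn
        (infty_mem_componentOfInfinity Ω)
        (fun _ => notMem_of_coe_mem_componentOfInfinity) hA hz hX

theorem subset_complComponentOfInfinity (Ω : Set ℂ) : Ω ⊆ complComponentOfInfinity Ω :=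
  fun _ hz hX => notMem_of_coe_mem_componentOfInfinity hX hz

theorem IsCompactPiece.empty {Ω : Set ℂ} (hΩ : IsOpen Ω) : IsCompactPiece Ω ∅ :=
  ⟨isCompact_empty, empty_subset _, by simpa using hΩ.isClosed_compl⟩

theorem complComponentOfInfinity_eq_sUnion {Ω : Set ℂ} (hΩ : IsOpen Ω) :
    complComponentOfInfinity Ω = ⋃₀ ((fun A => Ω ∪ A) '' {A | IsCompactPiece Ω A}) := by
  ext z
  rw [mem_complComponentOfInfinity_iff hΩ]
  constructor
  · rintro (hz | ⟨A, hA, hz⟩)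
    · exact ⟨_, ⟨∅, IsCompactPiece.empty hΩ, rfl⟩, Or.inl hz⟩
    · exact ⟨_, ⟨A, hA, rfl⟩, Or.inr hz⟩
  · rintro ⟨_, ⟨A, hA, rfl⟩, hz | hz⟩
    · exact Or.inl hz
    · exact Or.inr ⟨A, hA, hz⟩

theorem isOpen_complComponentOfInfinity {Ω : Set ℂ} (hΩ : IsOpen Ω) :
    IsOpen (complComponentOfInfinity Ω) := by
  rw [complComponentOfInfinity_eq_sUnion hΩ]
  refine isOpen_sUnion ?_
  rintro _ ⟨A, hA, rfl⟩
  exact IsCompactPiece.isOpen_union hA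

theorem isConnected_complComponentOfInfinity {Ω : Set ℂ} (hΩ : IsComplexDomain Ω) :
    IsConnected (complComponentOfInfinity Ω) := by
  obtain ⟨z, hz⟩ := hΩ.2.nonempty
  refine ⟨⟨z, subset_complComponentOfInfinity Ω hz⟩, ?_⟩
  rw [complComponentOfInfinity_eq_sUnion hΩ.1]
  refine isPreconnected_sUnion z _ ?_ ?_
  · rintro _ ⟨A, -, rfl⟩
    exact Or.inl hz
  · rintro _ ⟨A, hA, rfl⟩
    exact IsCompactPiece.isPreconnected_union hA hΩ.2

/-- The complement of the envelope in the sphere is the connected set `X ∋ ∞`, from which no compact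
piece can be split off. -/
theorem IsCompactPiece.eq_empty_of_complComponentOfInfinity {Ω E : Set ℂ}
    (hE : IsCompactPiece (complComponentOfInfinity Ω) E) : E = ∅ := by
  refine eq_empty_of_forall_notMem fun z hz => hE.subset_compl hz ?_
  exact coe_notMem_of_isPreconnected_of_isCompactPiece isPreconnected_connectedComponentIn
    (infty_mem_componentOfInfinity Ω) (fun w hw (h : w ∈ complComponentOfInfinity Ω) => h hw) hE hz

/-! ### Noncommutative cocycles on a square grid -/

section Grid

variable {Γ : Type*} [Group Γ]

/-- The values `gH i j` on the edge from `(i, j)` to `(i + 1, j)` and `gV i j` on the edge from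
`(i, j)` to `(i, j + 1)` multiply to the same element along the two ways around the square with
lower left corner `q`. -/
def GridSquareRel (gH gV : ℤ → ℤ → Γ) (q : ℤ × ℤ) : Prop :=
  gH q.1 q.2 * gV (q.1 + 1) q.2 = gV q.1 q.2 * gH q.1 (q.2 + 1)

/-- `h` is a potential of the edge values on the four sides of the square `q`. -/
def GridPotentialOn (gH gV : ℤ → ℤ → Γ) (h : ℤ → ℤ → Γ) (q : ℤ × ℤ) : Prop :=
  h (q.1 + 1) q.2 = h q.1 q.2 * gH q.1 q.2 ∧
  h (q.1 + 1) (q.2 + 1) = h q.1 (q.2 + 1) * gH q.1 (q.2 + 1) ∧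
  h q.1 (q.2 + 1) = h q.1 q.2 * gV q.1 q.2 ∧
  h (q.1 + 1) (q.2 + 1) = h (q.1 + 1) q.2 * gV (q.1 + 1) q.2

/-- The squares of the grid with corners in `[0, N]²`. -/
noncomputable def gridBox (N : ℕ) : Finset (ℤ × ℤ) := Finset.Ico 0 (N : ℤ) ×ˢ Finset.Ico 0 (N : ℤ)

theorem mem_gridBox {N : ℕ} {q : ℤ × ℤ} :
    q ∈ gridBox N ↔ (0 ≤ q.1 ∧ q.1 < N) ∧ 0 ≤ q.2 ∧ q.2 < N := by
  simp [gridBox]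

theorem exists_gridPotentialOn_gridBox (N : ℕ) (gH gV : ℤ → ℤ → Γ)
    (hg : ∀ q ∈ gridBox N, GridSquareRel gH gV q) :
    ∃ h : ℤ → ℤ → Γ, ∀ q ∈ gridBox N, GridPotentialOn gH gV h q := by
  -- The potential is the product along the bottom row and then up a column. Vertical edges are
  -- correct by definition, horizontal ones by induction on the height through the square relations.
  let hx : ℕ → Γ := fun n => Nat.rec 1 (fun k a => a * gH k 0) n
  let hy : ℕ → ℕ → Γ := fun m n => Nat.rec (hx m) (fun k a => a * gV m k) n
  have hyV : ∀ m n, hy m (n + 1) = hy m n * gV m n := fun m n => rfl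
  have hyH : ∀ m n : ℕ, m < N → n ≤ N → hy (m + 1) n = hy m n * gH m n := by
    intro m n hm hn
    induction n with
    | zero => rfl
    | succ k ih =>
      have hr := hg ((m : ℤ), (k : ℤ)) (mem_gridBox.2 (by simp; omega))
      simp only [GridSquareRel] at hr
      have e : gV ((m + 1 : ℕ) : ℤ) k = gV ((m : ℤ) + 1) k := by push_cast; rfl
      rw [hyV (m + 1) k, hyV m k, ih (by omega), e, mul_assoc, hr, mul_assoc]
      push_cast
      rfl
  refine ⟨fun i j => hy i.toNat j.toNat, fun q hq => ?_⟩
  obtain ⟨⟨h1, h2⟩, h3, h4⟩ := mem_gridBox.1 hq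
  obtain ⟨i, j⟩ := q
  lift i to ℕ using h1
  lift j to ℕ using h3
  simp only [Nat.cast_lt] at h2 h4
  have e : ∀ k : ℕ, ((k : ℤ) + 1).toNat = k + 1 := fun k => by omega
  simp only [GridPotentialOn, e, Int.toNat_natCast]
  refine ⟨hyH i j h2 h4.le, ?_, hyV i j, ?_⟩
  · have := hyH i (j + 1) h2 h4
    push_cast at this
    exact this
  · have := hyV (i + 1) j
    push_cast at this
    exact this

/-- Every cocycle on the squares of the box outside of `T` has a potential there. -/
def GridAcyclicOff (Γ : Type*) [Group Γ] (N : ℕ) (T : Finset (ℤ × ℤ)) : Prop :=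
  ∀ gH gV : ℤ → ℤ → Γ, (∀ q ∈ gridBox N, q ∉ T → GridSquareRel gH gV q) →
    ∃ h : ℤ → ℤ → Γ, ∀ q ∈ gridBox N, q ∉ T → GridPotentialOn gH gV h q

/-- The squares `q` and `q'` share a side. -/
def GridAdj (q q' : ℤ × ℤ) : Prop :=
  (q'.1 = q.1 ∧ (q'.2 = q.2 + 1 ∨ q.2 = q'.2 + 1)) ∨
  (q'.2 = q.2 ∧ (q'.1 = q.1 + 1 ∨ q.1 = q'.1 + 1))

/-- The side shared by `q` and `q'` belongs to no other square, and nothing is required at these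
two. Its value can therefore be redefined to force the relation at `q`, which reduces to `T`. -/
theorem GridAcyclicOff.insert {N : ℕ} {T : Finset (ℤ × ℤ)} (hT : GridAcyclicOff Γ N T)
    {q q' : ℤ × ℤ} (hadj : GridAdj q q') (hq' : q' ∈ T ∨ q' ∉ gridBox N) :
    GridAcyclicOff Γ N (insert q T) := by
  intro gH gV hg
  suffices H : ∃ gH' gV' : ℤ → ℤ → Γ, GridSquareRel gH' gV' q ∧
      ∀ p, p ≠ q → p ≠ q' → gH' p.1 p.2 = gH p.1 p.2 ∧ gH' p.1 (p.2 + 1) = gH p.1 (p.2 + 1) ∧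
        gV' p.1 p.2 = gV p.1 p.2 ∧ gV' (p.1 + 1) p.2 = gV (p.1 + 1) p.2 by
    obtain ⟨gH', gV', hrel, hagree⟩ := H
    have hne : ∀ p ∈ gridBox N, p ∉ T → p ≠ q' := by
      rintro p hp hpT rfl
      exact hq'.elim hpT (fun h => h hp)
    obtain ⟨h, hh⟩ := hT gH' gV' (fun p hp hpT => by
      by_cases hpq : p = q
      · rwa [hpq]
      · obtain ⟨e1, e2, e3, e4⟩ := hagree p hpq (hne p hp hpT)
        have := hg p hp (by simp [hpq, hpT])
        rwa [GridSquareRel, e1, e2, e3, e4])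
    refine ⟨h, fun p hp hpT => ?_⟩
    rw [Finset.mem_insert, not_or] at hpT
    obtain ⟨e1, e2, e3, e4⟩ := hagree p hpT.1 (hne p hp hpT.2)
    have := hh p hp hpT.2
    rwa [GridPotentialOn, e1, e2, e3, e4] at this
  obtain ⟨i, j⟩ := q
  obtain ⟨i', j'⟩ := q'
  simp only [GridAdj] at hadj
  simp only [GridSquareRel, ne_eq, Prod.forall, Prod.mk.injEq]
  rcases hadj with ⟨rfl, rfl | rfl⟩ | ⟨rfl, rfl | rfl⟩
  -- The neighbour `q'` is in turn above, below, to the right and to the left; the new value solves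
  -- the relation at `q` for the shared side.
  · refine ⟨fun a b => if a = i' ∧ b = j + 1 then (gV i' j)⁻¹ * (gH i' j * gV (i' + 1) j)
      else gH a b, gV, by simp, fun a b h1 h2 => ⟨if_neg (by omega), if_neg (by omega), rfl, rfl⟩⟩
  · refine ⟨fun a b => if a = i' ∧ b = j' + 1 then
        gV i' (j' + 1) * gH i' (j' + 1 + 1) * (gV (i' + 1) (j' + 1))⁻¹
      else gH a b, gV, by simp, fun a b h1 h2 => ⟨if_neg (by omega), if_neg (by omega), rfl, rfl⟩⟩
  · refine ⟨gH, fun a b => if a = i + 1 ∧ b = j' then (gH i j')⁻¹ * (gV i j' * gH i (j' + 1))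
      else gV a b, by simp, fun a b h1 h2 => ⟨rfl, rfl, if_neg (by omega), if_neg (by omega)⟩⟩
  · refine ⟨gH, fun a b => if a = i' + 1 ∧ b = j' then
        gH (i' + 1) j' * gV (i' + 1 + 1) j' * (gH (i' + 1) (j' + 1))⁻¹
      else gV a b, by simp, fun a b h1 h2 => ⟨rfl, rfl, if_neg (by omega), if_neg (by omega)⟩⟩

/-- Squares are removed starting from the empty set. A maximal removable `S ⊆ T` is all of `T`,
since otherwise some square of `T \ S` adjoins `S` or the outside of the box, and
`GridAcyclicOff.insert` enlarges `S`. -/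
theorem gridAcyclicOff_of_forall_subset {N : ℕ} {T : Finset (ℤ × ℤ)}
    (hT : ∀ R ⊆ T, R.Nonempty → (∀ q ∈ R, ∀ q', GridAdj q q' → q' ∈ gridBox N) →
      ∃ q ∈ R, ∃ q' ∈ T, GridAdj q q' ∧ q' ∉ R) :
    GridAcyclicOff Γ N T := by
  classical
  have hempty : GridAcyclicOff Γ N ∅ := fun gH gV hg => by
    obtain ⟨h, hh⟩ := exists_gridPotentialOn_gridBox N gH gV
      (fun q hq => hg q hq (Finset.notMem_empty q))
    exact ⟨h, fun q hq _ => hh q hq⟩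
  obtain ⟨S, hS, hmax⟩ := (T.powerset.filter (GridAcyclicOff Γ N)).exists_max_image Finset.card
    ⟨∅, by simp [hempty]⟩
  simp only [Finset.mem_filter, Finset.mem_powerset] at hS hmax
  rcases (T \ S).eq_empty_or_nonempty with h0 | h0
  · rw [Finset.sdiff_eq_empty_iff_subset] at h0
    rw [Finset.Subset.antisymm h0 hS.1]
    exact hS.2
  exfalso
  obtain ⟨q, hq, q', hadj, hq'⟩ : ∃ q ∈ T \ S, ∃ q', GridAdj q q' ∧ (q' ∈ S ∨ q' ∉ gridBox N) := by
    by_contra! hcon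
    obtain ⟨q, hq, q', hq'T, hadj, hq'⟩ := hT (T \ S) Finset.sdiff_subset h0
      (fun q hq q' hadj => (hcon q hq q' hadj).2)
    exact (hcon q hq q' hadj).1 (by simpa [hq'T] using hq')
  rw [Finset.mem_sdiff] at hq
  have := hmax (insert q S) ⟨Finset.insert_subset hq.1 hS.1, hS.2.insert hadj hq'⟩
  rw [Finset.card_insert_of_notMem hq.2] at this
  omega

end Grid

/-! ### Cocycles on plane domains without holes -/

section Cocycle

variable {Γ : Type*} [Group Γ]

/-- `g` is multiplicative on triples of points of any disc contained in `U`. -/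
def IsLocalCocycle (U : Set ℂ) (g : ℂ → ℂ → Γ) : Prop :=
  ∀ z r, Metric.ball z r ⊆ U → ∀ a ∈ Metric.ball z r, ∀ b ∈ Metric.ball z r,
    ∀ c ∈ Metric.ball z r, g a b * g b c = g a c

/-- The vertex `(i, j)` of the square grid with mesh `δ` and origin `c`. -/
def gridPoint (c : ℂ) (δ : ℝ) (i j : ℤ) : ℂ := ⟨c.re + δ * i, c.im + δ * j⟩

/-- The lower left corner of the grid square which contains `z`. -/
noncomputable def gridIndex (c : ℂ) (δ : ℝ) (z : ℂ) : ℤ × ℤ :=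
  (⌊(z.re - c.re) / δ⌋, ⌊(z.im - c.im) / δ⌋)

/-- The squares `q` and `q'` coincide or share a vertex. -/
def GridNear (q q' : ℤ × ℤ) : Prop :=
  (q.1 ≤ q'.1 + 1 ∧ q'.1 ≤ q.1 + 1) ∧ q.2 ≤ q'.2 + 1 ∧ q'.2 ≤ q.2 + 1

variable {c : ℂ} {δ : ℝ}

theorem gridIndex_spec (hδ : 0 < δ) (z : ℂ) :
    (δ * (gridIndex c δ z).1 ≤ z.re - c.re ∧ z.re - c.re < δ * ((gridIndex c δ z).1 + 1)) ∧
    (δ * (gridIndex c δ z).2 ≤ z.im - c.im ∧ z.im - c.im < δ * ((gridIndex c δ z).2 + 1)) := by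
  have key : ∀ x : ℝ, δ * ⌊x / δ⌋ ≤ x ∧ x < δ * (⌊x / δ⌋ + 1) := fun x => by
    have h1 := Int.floor_le (x / δ)
    have h2 := Int.lt_floor_add_one (x / δ)
    rw [le_div_iff₀ hδ] at h1
    rw [div_lt_iff₀ hδ] at h2
    exact ⟨by linarith, by linarith⟩
  exact ⟨key _, key _⟩

theorem int_lt_of_mul_lt_mul (hδ : 0 < δ) {m n : ℤ} (h : δ * m < δ * n) : m < n := by
  exact_mod_cast lt_of_mul_lt_mul_left h hδ.le

theorem gridNear_of_abs_lt (hδ : 0 < δ) {x : ℂ} {q : ℤ × ℤ}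
    (h1 : |x.re - (c.re + δ * (q.1 + 1 / 2))| < 3 / 2 * δ)
    (h2 : |x.im - (c.im + δ * (q.2 + 1 / 2))| < 3 / 2 * δ) : GridNear q (gridIndex c δ x) := by
  obtain ⟨⟨h3, h4⟩, h5, h6⟩ := gridIndex_spec (c := c) hδ x
  rw [abs_lt] at h1 h2
  have e1 : q.1 - 1 < (gridIndex c δ x).1 + 1 :=
    int_lt_of_mul_lt_mul hδ (by push_cast; linarith [h1.1])
  have e2 : (gridIndex c δ x).1 < q.1 + 2 :=
    int_lt_of_mul_lt_mul hδ (by push_cast; linarith [h1.2])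
  have e3 : q.2 - 1 < (gridIndex c δ x).2 + 1 :=
    int_lt_of_mul_lt_mul hδ (by push_cast; linarith [h2.1])
  have e4 : (gridIndex c δ x).2 < q.2 + 2 :=
    int_lt_of_mul_lt_mul hδ (by push_cast; linarith [h2.2])
  exact ⟨⟨by omega, by omega⟩, by omega, by omega⟩

theorem gridNear_gridIndex_of_dist_lt (hδ : 0 < δ) {x y : ℂ} (h : dist x y < δ) :
    GridNear (gridIndex c δ x) (gridIndex c δ y) := by
  obtain ⟨⟨h3, h4⟩, h5, h6⟩ := gridIndex_spec (c := c) hδ x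
  have h1 := (Complex.abs_re_le_norm (x - y)).trans_lt (by rwa [← dist_eq_norm])
  have h2 := (Complex.abs_im_le_norm (x - y)).trans_lt (by rwa [← dist_eq_norm])
  rw [Complex.sub_re, abs_lt] at h1
  rw [Complex.sub_im, abs_lt] at h2
  refine gridNear_of_abs_lt hδ ?_ ?_ <;> rw [abs_lt] <;> constructor <;> linarith

theorem abs_sub_lt_of_int (hδ : 0 < δ) {x y : ℝ} {m n k : ℤ}
    (hx : δ * m ≤ x ∧ x < δ * (m + 1)) (hy : δ * n ≤ y ∧ y < δ * (n + 1))
    (h1 : m ≤ n + k) (h2 : n ≤ m + k) : |x - y| < δ * (k + 1) := by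
  have e1 : (δ * m : ℝ) ≤ δ * (n + k) := by
    gcongr; exact_mod_cast h1
  have e2 : (δ * n : ℝ) ≤ δ * (m + k) := by
    gcongr; exact_mod_cast h2
  rw [abs_lt]
  constructor <;> linarith

theorem dist_le_abs_add_abs (x y : ℂ) : dist x y ≤ |x.re - y.re| + |x.im - y.im| := by
  rw [dist_eq_norm]
  exact Complex.norm_le_abs_re_add_abs_im (x - y)

theorem dist_lt_of_gridNear_of_gridNear (hδ : 0 < δ) {x y : ℂ} {q : ℤ × ℤ}
    (hx : GridNear q (gridIndex c δ x)) (hy : GridNear q (gridIndex c δ y)) :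
    dist x y < 6 * δ := by
  obtain ⟨h1, h2⟩ := gridIndex_spec (c := c) hδ x
  obtain ⟨h3, h4⟩ := gridIndex_spec (c := c) hδ y
  obtain ⟨⟨a1, a2⟩, a3, a4⟩ := hx
  obtain ⟨⟨b1, b2⟩, b3, b4⟩ := hy
  have e1 := abs_sub_lt_of_int hδ (k := 2) h1 h3 (by omega) (by omega)
  have e2 := abs_sub_lt_of_int hδ (k := 2) h2 h4 (by omega) (by omega)
  rw [sub_sub_sub_cancel_right] at e1 e2
  push_cast at e1 e2
  linarith [dist_le_abs_add_abs x y]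

theorem dist_gridPoint_lt (hδ : 0 < δ) {z : ℂ} {i j : ℤ}
    (h : GridNear (i, j) (gridIndex c δ z)) : dist (gridPoint c δ i j) z < 6 * δ := by
  obtain ⟨h1, h2⟩ := gridIndex_spec (c := c) hδ z
  obtain ⟨⟨a1, a2⟩, a3, a4⟩ := h
  have hr : ∀ k : ℤ, δ * k ≤ δ * k ∧ δ * k < δ * (k + 1) := fun k => ⟨le_rfl, by linarith⟩
  have e1 := abs_sub_lt_of_int hδ (k := 1) (hr i) h1 a1 a2
  have e2 := abs_sub_lt_of_int hδ (k := 1) (hr j) h2 a3 a4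
  have := dist_le_abs_add_abs (gridPoint c δ i j) z
  simp only [gridPoint] at this
  have f1 : δ * i - (z.re - c.re) = c.re + δ * i - z.re := by ring
  have f2 : δ * j - (z.im - c.im) = c.im + δ * j - z.im := by ring
  rw [f1] at e1
  rw [f2] at e2
  push_cast at e1 e2
  simp only [gridPoint]
  linarith

/-- The squares near a point of the complement of `U`. -/
def GridBad (U : Set ℂ) (c : ℂ) (δ : ℝ) (q : ℤ × ℤ) : Prop :=
  ∃ x ∉ U, GridNear q (gridIndex c δ x)

theorem ball_subset_of_not_gridBad (hδ : 0 < δ) {U : Set ℂ} {q : ℤ × ℤ}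
    (hq : ¬ GridBad U c δ q) :
    Metric.ball ⟨c.re + δ * (q.1 + 1 / 2), c.im + δ * (q.2 + 1 / 2)⟩ (3 / 2 * δ) ⊆ U := by
  intro x hx
  by_contra hxU
  rw [Metric.mem_ball, dist_eq_norm] at hx
  exact hq ⟨x, hxU, gridNear_of_abs_lt hδ ((Complex.abs_re_le_norm _).trans_lt hx)
    ((Complex.abs_im_le_norm _).trans_lt hx)⟩

theorem IsLocalCocycle.gridSquareRel (hδ : 0 < δ) {U : Set ℂ} {g : ℂ → ℂ → Γ}
    (hg : IsLocalCocycle U g) {q : ℤ × ℤ} (hq : ¬ GridBad U c δ q) :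
    GridSquareRel (fun i j => g (gridPoint c δ i j) (gridPoint c δ (i + 1) j))
      (fun i j => g (gridPoint c δ i j) (gridPoint c δ i (j + 1))) q := by
  have hcorner : ∀ i j : ℤ, (i = q.1 ∨ i = q.1 + 1) → (j = q.2 ∨ j = q.2 + 1) →
      gridPoint c δ i j ∈ Metric.ball
        (⟨c.re + δ * (q.1 + 1 / 2), c.im + δ * (q.2 + 1 / 2)⟩ : ℂ) (3 / 2 * δ) := by
    intro i j hi hj
    rw [Metric.mem_ball]
    have h1 : |c.re + δ * i - (c.re + δ * (q.1 + 1 / 2))| ≤ δ / 2 := by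
      rw [abs_le]
      rcases hi with rfl | rfl <;> push_cast <;> constructor <;> linarith
    have h2 : |c.im + δ * j - (c.im + δ * (q.2 + 1 / 2))| ≤ δ / 2 := by
      rw [abs_le]
      rcases hj with rfl | rfl <;> push_cast <;> constructor <;> linarith
    have h3 := dist_le_abs_add_abs (gridPoint c δ i j)
      ⟨c.re + δ * (q.1 + 1 / 2), c.im + δ * (q.2 + 1 / 2)⟩
    simp only [gridPoint] at h3 ⊢
    linarith
  have hb := ball_subset_of_not_gridBad hδ hq
  have h00 := hcorner q.1 q.2 (Or.inl rfl) (Or.inl rfl)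
  have h10 := hcorner (q.1 + 1) q.2 (Or.inr rfl) (Or.inl rfl)
  have h01 := hcorner q.1 (q.2 + 1) (Or.inl rfl) (Or.inr rfl)
  have h11 := hcorner (q.1 + 1) (q.2 + 1) (Or.inr rfl) (Or.inr rfl)
  simp only [GridSquareRel]
  rw [hg _ _ hb _ h00 _ h10 _ h11, hg _ _ hb _ h00 _ h01 _ h11]

/-- A set `R` of bad squares violating the removal criterion is closed under passing to bad
neighbours and stays off the rim of the box. The points of `Uᶜ` whose own square is in `R` then form
a nonempty compact piece. -/
theorem gridAcyclicOff_gridBad (hδ : 0 < δ) {U : Set ℂ} (hU : IsOpen U)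
    (hpiece : ∀ E, IsCompactPiece U E → E = ∅) (N : ℕ) {T : Finset (ℤ × ℤ)}
    (hT : ∀ q, q ∈ T ↔ q ∈ gridBox N ∧ GridBad U c δ q) : GridAcyclicOff Γ N T := by
  refine gridAcyclicOff_of_forall_subset fun R hRT hR hadj => ?_
  by_contra! hcon
  have hstep : ∀ q ∈ R, ∀ q', GridAdj q q' → GridBad U c δ q' → q' ∈ R := fun q hq q' h1 h2 =>
    hcon q hq q' ((hT q').2 ⟨hadj q hq q' h1, h2⟩) h1
  -- All nine squares of the block around a point of `Uᶜ` are bad, so `R` spreads through the block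
  -- by side steps: one row move and one column move connect any square with the centre.
  have hblock : ∀ x ∉ U, ∀ q ∈ R, ∀ q', GridNear q (gridIndex c δ x) →
      GridNear q' (gridIndex c δ x) → q.1 = q'.1 ∨ q.2 = q'.2 → q.1 ≤ q'.1 + 1 →
      q'.1 ≤ q.1 + 1 → q.2 ≤ q'.2 + 1 → q'.2 ≤ q.2 + 1 → q' ∈ R := by
    intro x hx q hq q' h1 h2 h3 h4 h5 h6 h7
    by_cases hqq : q = q'
    · exact hqq ▸ hq
    · refine hstep q hq q' ?_ ⟨x, hx, h2⟩
      rw [Prod.ext_iff] at hqq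
      simp only [GridAdj]
      omega
  have hcenter : ∀ x ∉ U, ∀ q ∈ R, GridNear q (gridIndex c δ x) → gridIndex c δ x ∈ R := by
    intro x hx q hq hn
    have hn' := hn
    simp only [GridNear] at hn'
    have h1 : (q.1, (gridIndex c δ x).2) ∈ R :=
      hblock x hx q hq _ hn (by simp only [GridNear]; omega) (Or.inl rfl) (by simp) (by simp)
        hn'.2.1 hn'.2.2
    exact hblock x hx _ h1 _ (by simp only [GridNear]; omega) (by simp only [GridNear]; omega)
      (Or.inr rfl) hn'.1.1 hn'.1.2 (by simp) (by simp)
  have hall : ∀ x ∉ U, gridIndex c δ x ∈ R → ∀ q, GridNear q (gridIndex c δ x) → q ∈ R := by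
    intro x hx hxR q hn
    have hn' := hn
    simp only [GridNear] at hn'
    have h1 : (q.1, (gridIndex c δ x).2) ∈ R :=
      hblock x hx _ hxR _ (by simp only [GridNear]; omega) (by simp only [GridNear]; omega)
        (Or.inr rfl) hn'.1.2 hn'.1.1 (by simp) (by simp)
    exact hblock x hx _ h1 _ (by simp only [GridNear]; omega) hn (Or.inl rfl) (by simp) (by simp)
      hn'.2.2 hn'.2.1
  set E : Set ℂ := {x | x ∉ U ∧ gridIndex c δ x ∈ R} with hE
  have hloc : ∀ x ∉ U, ∀ y ∉ U, dist x y < δ → x ∈ E → y ∈ E := fun x hx y hy hd hxE =>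
    ⟨hy, hall x hx hxE.2 _ (gridNear_gridIndex_of_dist_lt hδ (by rwa [dist_comm]))⟩
  -- `E` and `Uᶜ \ E` are at distance at least `δ`, so both are closed.
  have hclosed : ∀ F ⊆ Uᶜ, (∀ x ∉ U, ∀ y ∉ U, dist x y < δ → x ∈ F → y ∈ F) → IsClosed F := by
    intro F hF hFl
    refine isClosed_of_closure_subset fun x hx => ?_
    have hxU : x ∉ U := (closure_minimal hF hU.isClosed_compl) hx
    obtain ⟨y, hy, hd⟩ := Metric.mem_closure_iff.1 hx δ hδ
    exact hFl y (hF hy) x hxU (by rwa [dist_comm]) hy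
  have hEc : IsClosed E := hclosed E (fun x hx => hx.1) hloc
  have hEd : IsClosed (Uᶜ \ E) := hclosed _ sdiff_subset fun x hx y hy hd hxE =>
    ⟨hy, fun hyE => hxE.2 (hloc y hy x hx (by rwa [dist_comm]) hyE)⟩
  have hEb : IsCompact E := by
    refine (isCompact_Icc.reProdIm isCompact_Icc : IsCompact
      (Icc c.re (c.re + δ * N) ×ℂ Icc c.im (c.im + δ * N))).of_isClosed_subset hEc ?_
    intro x hx
    obtain ⟨⟨h1, h2⟩, h3, h4⟩ := gridIndex_spec (c := c) hδ x
    obtain ⟨⟨b1, b2⟩, b3, b4⟩ := mem_gridBox.1 ((hT _).1 (hRT hx.2)).1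
    have e1 : (0 : ℝ) ≤ δ * (gridIndex c δ x).1 := mul_nonneg hδ.le (by exact_mod_cast b1)
    have e2 : (0 : ℝ) ≤ δ * (gridIndex c δ x).2 := mul_nonneg hδ.le (by exact_mod_cast b3)
    have e3 : δ * ((gridIndex c δ x).1 + 1) ≤ δ * N := by
      gcongr; exact_mod_cast b2
    have e4 : δ * ((gridIndex c δ x).2 + 1) ≤ δ * N := by
      gcongr; exact_mod_cast b4
    exact ⟨⟨by linarith, by linarith⟩, by linarith, by linarith⟩
  have hE0 := hpiece E ⟨hEb, fun x hx => hx.1, hEd⟩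
  obtain ⟨q, hq⟩ := hR
  obtain ⟨x, hx, hn⟩ := ((hT q).1 (hRT hq)).2
  exact notMem_empty x (hE0 ▸ ⟨hx, hcenter x hx q hq hn⟩)

theorem IsLocalCocycle.self {U : Set ℂ} {g : ℂ → ℂ → Γ} (hg : IsLocalCocycle U g) {z : ℂ} {r : ℝ}
    (hb : Metric.ball z r ⊆ U) {a : ℂ} (ha : a ∈ Metric.ball z r) : g a a = 1 := by
  simpa using hg z r hb a ha a ha a ha

theorem IsLocalCocycle.exists_potential_on_compact {U : Set ℂ} {g : ℂ → ℂ → Γ}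
    (hg : IsLocalCocycle U g) (hU : IsOpen U) (hpiece : ∀ E, IsCompactPiece U E → E = ∅)
    {C : Set ℂ} (hC : IsCompact C) (hCU : C ⊆ U) :
    ∃ δ > 0, ∃ h : ℂ → Γ, ∀ a ∈ C, ∀ b ∈ C, dist a b < δ → h b = h a * g a b := by
  classical
  obtain ⟨ε, hε, hεU⟩ := hC.exists_thickening_subset_open hU hCU
  have hball : ∀ a ∈ C, Metric.ball a ε ⊆ U := fun a ha =>
    (Metric.ball_subset_thickening ha ε).trans hεU
  obtain ⟨M, hM⟩ := hC.isBounded.exists_norm_le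
  -- Points in squares near a common square, and grid vertices near a point, are within `6 * δ < ε`.
  -- Hence every square near a point of `C` is good.
  set δ := ε / 12 with hδε
  have hδ : 0 < δ := by positivity
  -- The margin keeps the neighbouring squares of each point of `C` inside the box.
  set c : ℂ := ⟨-M - 3 * δ, -M - 3 * δ⟩ with hc
  obtain ⟨N, hN⟩ := exists_nat_gt ((2 * M + 6 * δ) / δ)
  rw [div_lt_iff₀ hδ] at hN
  let T := (gridBox N).filter (GridBad U c δ)
  have hT : ∀ q, q ∈ T ↔ q ∈ gridBox N ∧ GridBad U c δ q := fun q => by simp [T]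
  let P := gridPoint c δ
  obtain ⟨h₀, hh₀⟩ := gridAcyclicOff_gridBad (Γ := Γ) hδ hU hpiece N hT
    (fun i j => g (P i j) (P (i + 1) j)) (fun i j => g (P i j) (P i (j + 1)))
    (fun q hq hqT => hg.gridSquareRel hδ fun hbad => hqT ((hT q).2 ⟨hq, hbad⟩))
  have hgood : ∀ a ∈ C, ∀ q, GridNear q (gridIndex c δ a) → GridPotentialOn
      (fun i j => g (P i j) (P (i + 1) j)) (fun i j => g (P i j) (P i (j + 1))) h₀ q := by
    intro a ha q hn
    refine hh₀ q ?_ ?_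
    · obtain ⟨⟨h1, h2⟩, h3, h4⟩ := gridIndex_spec (c := c) hδ a
      have hre := abs_le.1 ((Complex.abs_re_le_norm a).trans (hM a ha))
      have him := abs_le.1 ((Complex.abs_im_le_norm a).trans (hM a ha))
      simp only [hc] at h1 h2 h3 h4
      have e1 : 1 < (gridIndex c δ a).1 + 1 :=
        int_lt_of_mul_lt_mul hδ (by push_cast; linarith)
      have e2 : (gridIndex c δ a).1 < (N : ℤ) - 1 :=
        int_lt_of_mul_lt_mul hδ (by push_cast; linarith)
      have e3 : 1 < (gridIndex c δ a).2 + 1 :=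
        int_lt_of_mul_lt_mul hδ (by push_cast; linarith)
      have e4 : (gridIndex c δ a).2 < (N : ℤ) - 1 :=
        int_lt_of_mul_lt_mul hδ (by push_cast; linarith)
      obtain ⟨⟨a1, a2⟩, a3, a4⟩ := hn
      exact mem_gridBox.2 ⟨⟨by omega, by omega⟩, by omega, by omega⟩
    · intro hq
      obtain ⟨x, hx, hxn⟩ := ((hT q).1 hq).2
      have := dist_lt_of_gridNear_of_gridNear hδ hxn hn
      exact hx (hball a ha (Metric.mem_ball.2 (by linarith)))
  have hPmem : ∀ a ∈ C, ∀ i j, GridNear (i, j) (gridIndex c δ a) → P i j ∈ Metric.ball a ε :=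
    fun a ha i j hn => Metric.mem_ball.2 (by
      have := dist_gridPoint_lt hδ hn
      simp only [P]
      linarith)
  have hH : ∀ a ∈ C, ∀ i i' j, GridNear (i, j) (gridIndex c δ a) →
      GridNear (i', j) (gridIndex c δ a) → i ≤ i' + 1 → i' ≤ i + 1 →
      h₀ i' j = h₀ i j * g (P i j) (P i' j) := by
    intro a ha i i' j hn hn' h1 h2
    obtain rfl | rfl | rfl : i' = i ∨ i' = i + 1 ∨ i = i' + 1 := by omega
    · rw [hg.self (hball a ha) (hPmem a ha _ _ hn), mul_one]
    · exact (hgood a ha _ hn).1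
    · have := (hgood a ha _ hn').1
      simp only at this
      rw [this, mul_assoc, hg _ _ (hball a ha) _ (hPmem a ha _ _ hn') _ (hPmem a ha _ _ hn) _
        (hPmem a ha _ _ hn'), hg.self (hball a ha) (hPmem a ha _ _ hn'), mul_one]
  have hV : ∀ a ∈ C, ∀ i j j', GridNear (i, j) (gridIndex c δ a) →
      GridNear (i, j') (gridIndex c δ a) → j ≤ j' + 1 → j' ≤ j + 1 →
      h₀ i j' = h₀ i j * g (P i j) (P i j') := by
    intro a ha i j j' hn hn' h1 h2
    obtain rfl | rfl | rfl : j' = j ∨ j' = j + 1 ∨ j = j' + 1 := by omega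
    · rw [hg.self (hball a ha) (hPmem a ha _ _ hn), mul_one]
    · exact (hgood a ha _ hn).2.2.1
    · have := (hgood a ha _ hn').2.2.1
      simp only at this
      rw [this, mul_assoc, hg _ _ (hball a ha) _ (hPmem a ha _ _ hn') _ (hPmem a ha _ _ hn) _
        (hPmem a ha _ _ hn'), hg.self (hball a ha) (hPmem a ha _ _ hn'), mul_one]
  -- The grid potential at the corner of the square of `a`, continued from that corner to `a`. For
  -- nearby `a` and `b` the corners are joined by at most one horizontal and one vertical edge, all
  -- inside one disc in `U`.
  refine ⟨δ, hδ, fun a => h₀ (gridIndex c δ a).1 (gridIndex c δ a).2 *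
    g (P (gridIndex c δ a).1 (gridIndex c δ a).2) a, fun a ha b hb hab => ?_⟩
  have hn := gridNear_gridIndex_of_dist_lt (c := c) hδ hab
  set u := gridIndex c δ a with hu
  set v := gridIndex c δ b with hv
  simp only [GridNear] at hn
  have n1 : GridNear (u.1, u.2) (gridIndex c δ a) := by
    rw [← hu]; simp only [GridNear]; omega
  have n2 : GridNear (v.1, u.2) (gridIndex c δ a) := by
    rw [← hu]; simp only [GridNear]; omega
  have n3 : GridNear (v.1, v.2) (gridIndex c δ a) := by
    rw [← hu]; simp only [GridNear]; omega
  have m1 := hPmem a ha _ _ n1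
  have m2 := hPmem a ha _ _ n2
  have m3 := hPmem a ha _ _ n3
  have ma : a ∈ Metric.ball a ε := Metric.mem_ball_self hε
  have mb : b ∈ Metric.ball a ε := Metric.mem_ball.2 (by rw [dist_comm]; linarith)
  have hbl := hg a ε (hball a ha)
  simp only
  rw [hV a ha v.1 u.2 v.2 n2 n3 hn.2.1 hn.2.2, hH a ha u.1 v.1 u.2 n1 n2 hn.1.1 hn.1.2]
  simp only [mul_assoc]
  rw [hbl _ m2 _ m3 _ mb, hbl _ m1 _ m2 _ mb, hbl _ m1 _ ma _ mb]

end Cocycle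

/-! ### Simple connectivity of plane domains without holes -/

section LoopClass

variable {Y : Type*} [TopologicalSpace Y] {x : Y}

/-- The class in the (opposite) fundamental group at `x` of the loop obtained from the path `p` by
joining its end points to `x` along the paths `c`. -/
noncomputable def basedLoopClass (c : ∀ a : Y, Path x a) {a b : Y} (p : Path a b) :
    (FundamentalGroup Y x)ᵐᵒᵖ :=
  MulOpposite.op (((Path.Homotopic.Quotient.mk (c a)).trans (Path.Homotopic.Quotient.mk p)).trans
    (Path.Homotopic.Quotient.mk (c b)).symm)

variable (c : ∀ a : Y, Path x a)

theorem basedLoopClass_eq_of_homotopic {a b : Y} {p q : Path a b} (h : p.Homotopic q) :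
    basedLoopClass c p = basedLoopClass c q := by
  rw [basedLoopClass, Path.Homotopic.Quotient.eq.2 h, basedLoopClass]

/-- The opposite group makes products follow the order of concatenation; the detour to the base
point along `c b` cancels. -/
theorem basedLoopClass_trans {a b d : Y} (p : Path a b) (q : Path b d) :
    basedLoopClass c (p.trans q) = basedLoopClass c p * basedLoopClass c q := by
  rw [basedLoopClass, basedLoopClass, basedLoopClass, ← MulOpposite.op_mul,
    FundamentalGroup.mul_def, Path.Homotopic.Quotient.mk_trans]
  congr 1
  simp only [Path.Homotopic.Quotient.trans_assoc]
  congr 2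
  rw [← Path.Homotopic.Quotient.trans_assoc (Path.Homotopic.Quotient.mk (c b)).symm,
    Path.Homotopic.Quotient.symm_trans, Path.Homotopic.Quotient.refl_trans]

theorem basedLoopClass_refl (a : Y) : basedLoopClass c (Path.refl a) = 1 := by
  rw [basedLoopClass, Path.Homotopic.Quotient.mk_refl, Path.Homotopic.Quotient.trans_refl,
    Path.Homotopic.Quotient.trans_symm]
  rfl

theorem basedLoopClass_cast {a b a' b' : Y} (p : Path a b) (ha : a' = a) (hb : b' = b) :
    basedLoopClass c (p.cast ha hb) = basedLoopClass c p := by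
  subst ha hb
  rfl

/-- The path `c x` need not be constant, so the class is that of `p` only up to conjugation, which
is undone here. -/
theorem homotopic_refl_of_basedLoopClass_eq_one {p : Path x x} (h : basedLoopClass c p = 1) :
    p.Homotopic (Path.refl x) := by
  have h1 := congrArg MulOpposite.unop h
  rw [basedLoopClass, MulOpposite.unop_op, MulOpposite.unop_one, FundamentalGroup.one_def] at h1
  set q := Path.Homotopic.Quotient.mk (c x)
  have h2 := congrArg (fun r => (q.symm.trans r).trans q) h1
  simp only [← Path.Homotopic.Quotient.trans_assoc, Path.Homotopic.Quotient.symm_trans,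
    Path.Homotopic.Quotient.refl_trans] at h2
  rw [Path.Homotopic.Quotient.trans_assoc, Path.Homotopic.Quotient.symm_trans,
    Path.Homotopic.Quotient.trans_refl, Path.Homotopic.Quotient.trans_refl,
    Path.Homotopic.Quotient.symm_trans, ← Path.Homotopic.Quotient.mk_refl] at h2
  exact Path.Homotopic.Quotient.eq.1 h2

end LoopClass

theorem Path.homotopic_of_mem_convex {U S : Set ℂ} (hS : Convex ℝ S) (hSU : S ⊆ U) {a b : U}
    (p q : Path a b) (hp : ∀ t, (p t : ℂ) ∈ S) (hq : ∀ t, (q t : ℂ) ∈ S) : p.Homotopic q := by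
  have ha : (a : ℂ) ∈ S := by simpa using hp 0
  have hb : (b : ℂ) ∈ S := by simpa using hp 1
  have : ContractibleSpace S := hS.contractibleSpace ⟨a, ha⟩
  have key : ∀ r : Path a b, (∀ t, (r t : ℂ) ∈ S) →
      ∃ r' : Path (⟨a, ha⟩ : S) ⟨b, hb⟩, ∀ t, (r' t : ℂ) = r t := fun r hr =>
    ⟨{ toFun := fun t => ⟨r t, hr t⟩
       continuous_toFun := by fun_prop
       source' := by simp
       target' := by simp }, fun t => rfl⟩
  obtain ⟨p', hp'⟩ := key p hp
  obtain ⟨q', hq'⟩ := key q hq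
  have h := (SimplyConnectedSpace.paths_homotopic p' q').map
    (⟨Set.inclusion hSU, continuous_inclusion hSU⟩ : C(S, U))
  have hmap : ∀ (r : Path a b) (r' : Path (⟨a, ha⟩ : S) ⟨b, hb⟩), (∀ t, (r' t : ℂ) = r t) →
      r'.map (continuous_inclusion hSU) = r := fun r r' hr =>
    Path.ext (funext fun t => Subtype.ext (hr t))
  rw [← hmap p p' hp', ← hmap q q' hq']
  exact h

theorem lineMap_mem_segment_of_mem_Icc (a b : ℂ) {t : ℝ} (ht : t ∈ Icc (0 : ℝ) 1) :
    AffineMap.lineMap a b t ∈ segment ℝ a b := by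
  rw [segment_eq_image_lineMap]
  exact ⟨t, ht, rfl⟩

/-- The straight path between two points of `U` joined by a segment in `U`. -/
noncomputable def segmentPath {U : Set ℂ} (a b : U) (h : segment ℝ (a : ℂ) b ⊆ U) : Path a b where
  toFun t := ⟨AffineMap.lineMap (a : ℂ) (b : ℂ) (t : ℝ), h (lineMap_mem_segment_of_mem_Icc _ _ t.2)⟩
  continuous_toFun := by
    refine Continuous.subtype_mk ?_ _
    exact AffineMap.lineMap_continuous.comp continuous_subtype_val
  source' := by simp
  target' := by simp

open Classical in
/-- The class of the straight path from `a` to `b`, or `1` if this path leaves `U`. -/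
noncomputable def segmentClass {U : Set ℂ} {x : U} (c : ∀ a : U, Path x a) (a b : ℂ) :
    (FundamentalGroup U x)ᵐᵒᵖ :=
  if h : segment ℝ a b ⊆ U then
    basedLoopClass c (segmentPath ⟨a, h (left_mem_segment ℝ a b)⟩
      ⟨b, h (right_mem_segment ℝ a b)⟩ h)
  else 1

theorem segmentClass_eq {U S : Set ℂ} {x : U} (c : ∀ a : U, Path x a) (hS : Convex ℝ S)
    (hSU : S ⊆ U) {a b : U} (p : Path a b) (hp : ∀ t, (p t : ℂ) ∈ S) :
    segmentClass c (a : ℂ) b = basedLoopClass c p := by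
  have hseg : segment ℝ (a : ℂ) b ⊆ S :=
    hS.segment_subset (by simpa using hp 0) (by simpa using hp 1)
  rw [segmentClass, dif_pos (hseg.trans hSU)]
  refine basedLoopClass_eq_of_homotopic c (Path.homotopic_of_mem_convex hS hSU _ _ ?_ hp)
  exact fun t => hseg (lineMap_mem_segment_of_mem_Icc _ _ t.2)

theorem isLocalCocycle_segmentClass {U : Set ℂ} {x : U} (c : ∀ a : U, Path x a) :
    IsLocalCocycle U (segmentClass c) := by
  intro z r hball a ha b hb d hd
  have hS := convex_ball z r
  have hmem : ∀ a b : U, (a : ℂ) ∈ Metric.ball z r → (b : ℂ) ∈ Metric.ball z r →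
      ∃ p : Path a b, ∀ t, (p t : ℂ) ∈ Metric.ball z r := fun a b ha hb =>
    ⟨segmentPath a b ((hS.segment_subset ha hb).trans hball), fun t =>
      hS.segment_subset ha hb (lineMap_mem_segment_of_mem_Icc _ _ t.2)⟩
  obtain ⟨p, hp⟩ := hmem ⟨a, hball ha⟩ ⟨b, hball hb⟩ ha hb
  obtain ⟨q, hq⟩ := hmem ⟨b, hball hb⟩ ⟨d, hball hd⟩ hb hd
  have h1 := segmentClass_eq c hS hball p hp
  have h2 := segmentClass_eq c hS hball q hq
  have h3 := segmentClass_eq c hS hball (p.trans q) (fun t => by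
    rw [Path.trans_apply]
    split_ifs
    · exact hp _
    · exact hq _)
  simp only at h1 h2 h3
  rw [h1, h2, h3, basedLoopClass_trans]

theorem isSimplyConnected_of_no_compactPiece {U : Set ℂ} (hU : IsOpen U) (hUc : IsConnected U)
    (hpiece : ∀ E, IsCompactPiece U E → E = ∅) : IsSimplyConnected U := by
  have hpc : IsPathConnected U := hU.isConnected_iff_isPathConnected.1 hUc
  have hpcs : PathConnectedSpace U := isPathConnected_iff_pathConnectedSpace.1 hpc
  refine simply_connected_iff_loops_nullhomotopic.2 ⟨hpcs, fun x γ => ?_⟩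
  let c : ∀ a : U, Path x a := fun a => (PathConnectedSpace.joined x a).somePath
  have hγc : Continuous fun t => (γ t : ℂ) := by fun_prop
  obtain ⟨δ, hδ, h, hh⟩ := (isLocalCocycle_segmentClass c).exists_potential_on_compact hU hpiece
    (isCompact_range hγc) (by rintro _ ⟨t, rfl⟩; exact (γ t).2)
  -- On short parameter intervals `γ` stays in a disc, where its class is the straight one and
  -- matches the increment of `h`. So `Φ` is constant, and since `γ` is closed the factors `h` at
  -- both ends cancel.
  let Φ : unitInterval → (FundamentalGroup U x)ᵐᵒᵖ := fun t =>
    basedLoopClass c (γ.subpath 0 t) * (h (γ t))⁻¹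
  have hΦ : IsLocallyConstant Φ := by
    rw [IsLocallyConstant.iff_eventually_eq]
    intro t
    obtain ⟨r, hr, hrU⟩ := Metric.isOpen_iff.1 hU (γ t) (γ t).2
    have hρ : 0 < min r δ := lt_min hr hδ
    obtain ⟨η, hη, hηγ⟩ := Metric.continuous_iff.1 hγc t (min r δ) hρ
    refine Metric.eventually_nhds_iff.2 ⟨η, hη, fun s hs => ?_⟩
    have hball : Metric.ball (γ t : ℂ) (min r δ) ⊆ U :=
      (Metric.ball_subset_ball (min_le_left _ _)).trans hrU
    have hsub : ∀ u, (γ.subpath t s u : ℂ) ∈ Metric.ball (γ t : ℂ) (min r δ) := by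
      intro u
      have hu : γ.subpath t s u ∈ range (γ.subpath t s) := mem_range_self u
      rw [Path.range_subpath] at hu
      obtain ⟨v, hv, hvu⟩ := hu
      rw [← hvu]
      refine hηγ v (lt_of_le_of_lt ?_ hs)
      rw [Subtype.dist_eq, Subtype.dist_eq, dist_comm, dist_comm (s : ℝ)]
      refine Real.dist_left_le_of_mem_uIcc ?_
      rw [mem_uIcc] at hv ⊢
      exact hv
    have h1 := segmentClass_eq c (convex_ball _ _) hball (γ.subpath t s) hsub
    have h2 := hh (γ t) ⟨t, rfl⟩ (γ s) ⟨s, rfl⟩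
      (by rw [dist_comm]; exact (hηγ s hs).trans_le (min_le_right _ _))
    have h3 : basedLoopClass c (γ.subpath 0 s) =
        basedLoopClass c (γ.subpath 0 t) * basedLoopClass c (γ.subpath t s) := by
      rw [← basedLoopClass_trans]
      exact (basedLoopClass_eq_of_homotopic c
        ⟨Path.Homotopy.subpathTransSubpath γ 0 t s⟩).symm
    simp only [Φ]
    rw [h3, h2, h1]
    group
  have h01 : Φ 1 = Φ 0 := hΦ.apply_eq_of_isPreconnected isPreconnected_univ trivial trivial
  simp only [Φ, Path.subpath_self, basedLoopClass_refl, Path.subpath_zero_one,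
    basedLoopClass_cast] at h01
  rw [γ.source, γ.target] at h01
  exact homotopic_refl_of_basedLoopClass_eq_one c (mul_right_cancel h01)

/-! ### Polygonal integrals and primitives -/

theorem integral_lineMap_eq_sub {f φ : ℂ → ℂ} {a b : ℂ} {s t : ℝ}
    (hf : ContinuousOn (fun u : ℝ => f (AffineMap.lineMap a b u)) (uIcc s t))
    (hφ : ∀ u ∈ uIcc s t, HasDerivAt φ (f (AffineMap.lineMap a b u)) (AffineMap.lineMap a b u)) :
    ∫ u in s..t, f (AffineMap.lineMap a b u) * (b - a) =
      φ (AffineMap.lineMap a b t) - φ (AffineMap.lineMap a b s) := by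
  refine intervalIntegral.integral_eq_sub_of_hasDerivAt
    (f := fun u : ℝ => φ (AffineMap.lineMap a b u)) (fun u hu => ?_)
    (hf.mul continuousOn_const).intervalIntegrable
  have h1 : HasDerivAt (fun u : ℝ => (AffineMap.lineMap a b u : ℂ)) (b - a) u :=
    AffineMap.hasDerivAt_lineMap
  simpa [smul_eq_mul, mul_comm] using! (hφ u hu).scomp u h1

theorem continuousOn_comp_lineMap {f : ℂ → ℂ} {a b : ℂ} {Ω : Set ℂ} (hf : ContinuousOn f Ω)
    (h : segment ℝ a b ⊆ Ω) :
    ContinuousOn (fun u : ℝ => f (AffineMap.lineMap a b u)) (Icc 0 1) :=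
  hf.comp AffineMap.lineMap_continuous.continuousOn
    fun _ ht => h (lineMap_mem_segment_of_mem_Icc a b ht)

theorem segmentIntegral_eq_sub {f φ : ℂ → ℂ} {a b : ℂ} {Ω : Set ℂ} (hf : ContinuousOn f Ω)
    (h : segment ℝ a b ⊆ Ω) (hφ : ∀ z ∈ Ω, HasDerivAt φ (f z) z) :
    segmentIntegral f a b = φ b - φ a := by
  have := integral_lineMap_eq_sub (f := f) (φ := φ) (a := a) (b := b) (s := 0) (t := 1)
    (by rw [uIcc_of_le zero_le_one]; exact continuousOn_comp_lineMap hf h)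
    (fun u hu => hφ _ (h (lineMap_mem_segment_of_mem_Icc a b
      (by rwa [uIcc_of_le zero_le_one] at hu))))
  simpa [segmentIntegral] using this

theorem segmentIntegral_symm (f : ℂ → ℂ) (a b : ℂ) :
    segmentIntegral f b a = -segmentIntegral f a b := by
  have h := intervalIntegral.integral_comp_sub_left
    (fun u : ℝ => f (AffineMap.lineMap a b u) * (b - a)) (a := 0) (b := 1) 1
  simp only [sub_self, sub_zero] at h
  rw [segmentIntegral, segmentIntegral, ← h, ← intervalIntegral.integral_neg]
  congr 1
  ext u
  rw [AffineMap.lineMap_apply_one_sub]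
  ring

theorem ClosedPolygonalLine.integral_eq_zero_of_sub {Ω : Set ℂ} (γ : ClosedPolygonalLine Ω)
    {f ψ : ℂ → ℂ} (h : ∀ i : Fin γ.numSides,
      segmentIntegral f (γ.vertex i.castSucc) (γ.vertex i.succ) =
        ψ (γ.vertex i.succ) - ψ (γ.vertex i.castSucc)) : γ.integral f = 0 := by
  rw [ClosedPolygonalLine.integral, Finset.sum_congr rfl fun i _ => h i, Finset.sum_sub_distrib]
  have h1 := Fin.sum_univ_succ fun i => ψ (γ.vertex i)
  have h2 := Fin.sum_univ_castSucc fun i => ψ (γ.vertex i)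
  rw [γ.closed] at h2
  linear_combination h2 - h1

theorem ClosedPolygonalLine.integral_eq_zero_of_isExactOn {Ω : Set ℂ} (hΩ : IsOpen Ω)
    (γ : ClosedPolygonalLine Ω) {f : ℂ → ℂ} (hf : Complex.IsExactOn f Ω) : γ.integral f = 0 := by
  have hc := (hf.differentiableOn hΩ).continuousOn
  obtain ⟨φ, hφ⟩ := hf
  exact γ.integral_eq_zero_of_sub fun i => segmentIntegral_eq_sub hc (γ.side_subset i) hφ

/-- `v` is the integral of `f` along some polygonal line in `Ω` from `a` to `b`. -/
inductive IsPolygonalIntegral (f : ℂ → ℂ) (Ω : Set ℂ) (a : ℂ) : ℂ → ℂ → Prop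
  | nil : IsPolygonalIntegral f Ω a a 0
  | snoc {b c v : ℂ} : IsPolygonalIntegral f Ω a b v → segment ℝ b c ⊆ Ω →
      IsPolygonalIntegral f Ω a c (v + segmentIntegral f b c)

namespace IsPolygonalIntegral

variable {f : ℂ → ℂ} {Ω : Set ℂ} {a b c v w : ℂ}

theorem trans (h : IsPolygonalIntegral f Ω a b v) (h' : IsPolygonalIntegral f Ω b c w) :
    IsPolygonalIntegral f Ω a c (v + w) := by
  induction h' with
  | nil => simpa using h
  | snoc _ hseg ih => rw [← add_assoc]; exact ih.snoc hseg

theorem of_segment (h : segment ℝ a b ⊆ Ω) :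
    IsPolygonalIntegral f Ω a b (segmentIntegral f a b) := by
  simpa using nil.snoc h

theorem symm (h : IsPolygonalIntegral f Ω a b v) : IsPolygonalIntegral f Ω b a (-v) := by
  induction h with
  | nil => simpa using nil
  | snoc _ hseg ih =>
    rw [neg_add_rev, ← segmentIntegral_symm]
    exact (of_segment (by rwa [segment_symm])).trans ih

theorem exists_vertex (h : IsPolygonalIntegral f Ω a b v) :
    ∃ (n : ℕ) (p : Fin (n + 1) → ℂ), p 0 = a ∧ p (Fin.last n) = b ∧
      (∀ i : Fin n, segment ℝ (p i.castSucc) (p i.succ) ⊆ Ω) ∧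
      ∑ i : Fin n, segmentIntegral f (p i.castSucc) (p i.succ) = v := by
  induction h with
  | nil => exact ⟨0, fun _ => a, rfl, rfl, fun i => i.elim0, by simp⟩
  | @snoc b c v _ hseg ih =>
    obtain ⟨n, p, h0, hn, hs, hv⟩ := ih
    refine ⟨n + 1, Fin.snoc p c, ?_, by simp, ?_, ?_⟩
    · have : (0 : Fin (n + 2)) = Fin.castSucc 0 := rfl
      rw [this, Fin.snoc_castSucc, h0]
    · intro i
      refine Fin.lastCases ?_ (fun j => ?_) i
      · rw [Fin.snoc_castSucc, Fin.succ_last, Fin.snoc_last, hn]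
        exact hseg
      · rw [Fin.snoc_castSucc, Fin.succ_castSucc, Fin.snoc_castSucc]
        exact hs j
    · rw [Fin.sum_univ_castSucc]
      simp only [Fin.snoc_castSucc, Fin.succ_last, Fin.snoc_last, Fin.succ_castSucc, hn, hv]

theorem eq_zero_of_closed (hf : ∀ γ : ClosedPolygonalLine Ω, γ.integral f = 0)
    (h : IsPolygonalIntegral f Ω a a v) : v = 0 := by
  obtain ⟨n, p, h0, hn, hs, hv⟩ := h.exists_vertex
  rcases Nat.eq_zero_or_pos n with rfl | hpos
  · simpa using hv.symm
  · rw [← hv]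
    exact hf ⟨n, hpos, p, hn.trans h0.symm, hs⟩

theorem exists_of_isPreconnected (f : ℂ → ℂ) (hΩ : IsOpen Ω) (hc : IsPreconnected Ω)
    (ha : a ∈ Ω) (hb : b ∈ Ω) : ∃ v, IsPolygonalIntegral f Ω a b v := by
  have key : ∀ z ∈ Ω, ∃ r > 0, Metric.ball z r ⊆ Ω ∧ ∀ w ∈ Metric.ball z r,
      ((∃ v, IsPolygonalIntegral f Ω a z v) ↔ ∃ v, IsPolygonalIntegral f Ω a w v) := by
    intro z hz
    obtain ⟨r, hr, hball⟩ := Metric.isOpen_iff.1 hΩ z hz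
    refine ⟨r, hr, hball, fun w hw => ?_⟩
    have hseg : segment ℝ z w ⊆ Ω :=
      ((convex_ball z r).segment_subset (Metric.mem_ball_self hr) hw).trans hball
    exact ⟨fun ⟨v, hv⟩ => ⟨_, hv.snoc hseg⟩,
      fun ⟨v, hv⟩ => ⟨_, hv.snoc (segment_symm ℝ z w ▸ hseg)⟩⟩
  have hu : IsOpen {z | z ∈ Ω ∧ ∃ v, IsPolygonalIntegral f Ω a z v} := by
    refine Metric.isOpen_iff.2 fun z hz => ?_
    obtain ⟨r, hr, hball, h⟩ := key z hz.1
    exact ⟨r, hr, fun w hw => ⟨hball hw, (h w hw).1 hz.2⟩⟩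
  have hv : IsOpen {z | z ∈ Ω ∧ ¬ ∃ v, IsPolygonalIntegral f Ω a z v} := by
    refine Metric.isOpen_iff.2 fun z hz => ?_
    obtain ⟨r, hr, hball, h⟩ := key z hz.1
    exact ⟨r, hr, fun w hw => ⟨hball hw, fun hw' => hz.2 ((h w hw).2 hw')⟩⟩
  by_contra hcon
  obtain ⟨z, -, hz1, hz2⟩ := hc _ _ hu hv
    (fun z hz => (em (∃ v, IsPolygonalIntegral f Ω a z v)).imp (fun h => ⟨hz, h⟩)
      fun h => ⟨hz, h⟩) ⟨a, ha, ha, 0, nil⟩ ⟨b, hb, hb, hcon⟩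
  exact hz2.2 hz1.2

end IsPolygonalIntegral

/-- Any choice of polygonal integrals from a base point works: closed integrals vanish, so on each
disc in `Ω` the choice differs from a local primitive by a constant. -/
theorem isExactOn_of_integral_eq_zero {Ω : Set ℂ} (hΩ : IsOpen Ω) (hc : IsConnected Ω) {f : ℂ → ℂ}
    (hf : DifferentiableOn ℂ f Ω) (h : ∀ γ : ClosedPolygonalLine Ω, γ.integral f = 0) :
    Complex.IsExactOn f Ω := by
  obtain ⟨a, ha⟩ := hc.nonempty
  choose! φ hφ using fun z hz =>
    IsPolygonalIntegral.exists_of_isPreconnected f hΩ hc.isPreconnected ha (b := z) hz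
  refine ⟨φ, fun z hz => ?_⟩
  obtain ⟨r, hr, hball⟩ := Metric.isOpen_iff.1 hΩ z hz
  obtain ⟨ψ, hψ⟩ := (hf.mono hball).isExactOn_ball
  have hzr := Metric.mem_ball_self (x := z) hr
  have heq : ∀ w ∈ Metric.ball z r, φ w = ψ w + (φ z - ψ z) := by
    intro w hw
    have hseg := (convex_ball z r).segment_subset hzr hw
    have h1 := ((hφ z hz).snoc (hseg.trans hball)).trans (hφ w (hball hw)).symm
    have h2 := IsPolygonalIntegral.eq_zero_of_closed h h1
    rw [segmentIntegral_eq_sub (hf.continuousOn.mono hball) hseg hψ] at h2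
    linear_combination -h2
  refine ((hψ z hzr).add_const (φ z - ψ z)).congr_of_eventuallyEq ?_
  filter_upwards [Metric.ball_mem_nhds z hr] with w hw using heq w hw

theorem isLocalCocycle_segmentIntegral {U : Set ℂ} {F : ℂ → ℂ} (hF : DifferentiableOn ℂ F U) :
    IsLocalCocycle U fun a b => Multiplicative.ofAdd (segmentIntegral F a b) := by
  intro z r hball a ha b hb c hc
  have hFb := hF.mono hball
  obtain ⟨φ, hφ⟩ := hFb.isExactOn_ball
  have key : ∀ a ∈ Metric.ball z r, ∀ b ∈ Metric.ball z r, segmentIntegral F a b = φ b - φ a :=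
    fun a ha b hb =>
      segmentIntegral_eq_sub hFb.continuousOn ((convex_ball z r).segment_subset ha hb) hφ
  simp only
  rw [← ofAdd_add, key a ha b hb, key b hb c hc, key a ha c hc]
  congr 1
  ring

/-- The potential is only known for points closer than `δ`; the partial integral minus `h` is
locally constant along the segment. -/
theorem segmentIntegral_eq_sub_of_local_potential {U : Set ℂ} (hU : IsOpen U) {F : ℂ → ℂ}
    (hF : DifferentiableOn ℂ F U) {a b : ℂ} (hseg : segment ℝ a b ⊆ U) {δ : ℝ} (hδ : 0 < δ)
    {h : ℂ → ℂ} (hh : ∀ z ∈ segment ℝ a b, ∀ w ∈ segment ℝ a b, dist z w < δ →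
      h w = h z + segmentIntegral F z w) : segmentIntegral F a b = h b - h a := by
  let l : ℝ → ℂ := AffineMap.lineMap a b
  have hl : Continuous l := AffineMap.lineMap_continuous
  have hlseg : ∀ t : unitInterval, l t ∈ segment ℝ a b := fun t =>
    lineMap_mem_segment_of_mem_Icc a b t.2
  have hFl : ContinuousOn (fun u => F (l u)) (Icc 0 1) :=
    continuousOn_comp_lineMap hF.continuousOn hseg
  have hint : ∀ s t : unitInterval,
      IntervalIntegrable (fun u => F (l u) * (b - a)) MeasureTheory.volume s t := fun s t =>
    ((hFl.mul continuousOn_const).mono (uIcc_subset_Icc s.2 t.2)).intervalIntegrable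
  let Φ : unitInterval → ℂ := fun t => (∫ u in (0 : ℝ)..t, F (l u) * (b - a)) - h (l t)
  have hΦ : IsLocallyConstant Φ := by
    rw [IsLocallyConstant.iff_eventually_eq]
    intro t
    obtain ⟨r, hr, hrU⟩ := Metric.isOpen_iff.1 hU (l t) (hseg (hlseg t))
    have hρ : 0 < min r δ := lt_min hr hδ
    obtain ⟨η, hη, hηl⟩ := Metric.continuous_iff.1 hl t (min r δ) hρ
    refine Metric.eventually_nhds_iff.2 ⟨η, hη, fun s hs => ?_⟩
    have hball : Metric.ball (l t) (min r δ) ⊆ U :=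
      (Metric.ball_subset_ball (min_le_left _ _)).trans hrU
    have hFb := hF.mono hball
    obtain ⟨φ, hφ⟩ := hFb.isExactOn_ball
    have hmem : ∀ u ∈ uIcc (t : ℝ) s, l u ∈ Metric.ball (l t) (min r δ) := fun u hu =>
      hηl u (by
        rw [dist_comm]
        refine (Real.dist_left_le_of_mem_uIcc hu).trans_lt ?_
        rw [dist_comm]
        exact hs)
    have h1 : ∫ u in (t : ℝ)..s, F (l u) * (b - a) = φ (l s) - φ (l t) :=
      integral_lineMap_eq_sub (hFl.mono (uIcc_subset_Icc t.2 s.2)) fun u hu => hφ _ (hmem u hu)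
    have h2 : segmentIntegral F (l t) (l s) = φ (l s) - φ (l t) :=
      segmentIntegral_eq_sub hFb.continuousOn ((convex_ball _ _).segment_subset
        (Metric.mem_ball_self hρ) (hmem s right_mem_uIcc)) hφ
    have h3 := hh (l t) (hlseg t) (l s) (hlseg s)
      (by rw [dist_comm]; exact (hmem s right_mem_uIcc).trans_le (min_le_right _ _))
    have h4 := intervalIntegral.integral_add_adjacent_intervals (hint 0 t) (hint t s)
    rw [Icc.coe_zero] at h4
    simp only [Φ]
    rw [← h4, h1, h3, h2]
    ring
  have h01 : Φ 1 = Φ 0 := hΦ.apply_eq_of_isPreconnected isPreconnected_univ trivial trivial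
  simp only [Φ, Icc.coe_zero, Icc.coe_one, intervalIntegral.integral_same, l,
    AffineMap.lineMap_apply_one, AffineMap.lineMap_apply_zero] at h01
  rw [segmentIntegral]
  linear_combination h01

theorem isExactOn_of_no_compactPiece {U : Set ℂ} (hU : IsOpen U) (hUc : IsConnected U)
    (hpiece : ∀ E, IsCompactPiece U E → E = ∅) {F : ℂ → ℂ} (hF : DifferentiableOn ℂ F U) :
    Complex.IsExactOn F U := by
  refine isExactOn_of_integral_eq_zero hU hUc hF fun γ => ?_
  let C : Set ℂ := ⋃ i : Fin γ.numSides, segment ℝ (γ.vertex i.castSucc) (γ.vertex i.succ)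
  have hC : IsCompact C := isCompact_iUnion fun i => by
    rw [segment_eq_image_lineMap]
    exact isCompact_Icc.image (AffineMap.lineMap_continuous (R := ℝ))
  obtain ⟨δ, hδ, h, hh⟩ := (isLocalCocycle_segmentIntegral hF).exists_potential_on_compact hU
    hpiece hC (iUnion_subset γ.side_subset)
  refine γ.integral_eq_zero_of_sub (ψ := fun z => (h z).toAdd) fun i =>
    segmentIntegral_eq_sub_of_local_potential hU hF (γ.side_subset i) hδ fun z hz w hw hzw => ?_
  rw [hh z (mem_iUnion_of_mem i hz) w (mem_iUnion_of_mem i hw) hzw]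
  rfl

/-! ### Iterated primitives, polynomial factors and logarithms -/

theorem exists_iteratedDeriv_eq_of_isExactOn {U : Set ℂ} (hU : IsOpen U)
    (hex : ∀ F : ℂ → ℂ, DifferentiableOn ℂ F U → Complex.IsExactOn F U) (n : ℕ) :
    ∀ F : ℂ → ℂ, DifferentiableOn ℂ F U →
      ∃ φ : ℂ → ℂ, DifferentiableOn ℂ φ U ∧ ∀ z ∈ U, iteratedDeriv n φ z = F z := by
  induction n with
  | zero => exact fun F hF => ⟨F, hF, fun z _ => by simp⟩
  | succ n ih =>
    intro F hF
    obtain ⟨Ψ, hΨ⟩ := hex F hF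
    obtain ⟨φ, hφ, hφΨ⟩ := ih Ψ fun z hz => (hΨ z hz).differentiableAt.differentiableWithinAt
    refine ⟨φ, hφ, fun z hz => ?_⟩
    rw [iteratedDeriv_succ]
    refine ((hΨ z hz).congr_of_eventuallyEq ?_).deriv
    filter_upwards [hU.mem_nhds hz] with w hw using hφΨ w hw

/-- Integration by parts: a primitive of `P φ⁽ⁿ⁺¹⁾` is `P φ⁽ⁿ⁾` minus one of `P' φ⁽ⁿ⁾`. Degree and
order drop together until the polynomial is zero. -/
theorem isExactOn_eval_mul_of_iteratedDeriv_eq {Ω : Set ℂ} (hΩ : IsOpen Ω) {φ : ℂ → ℂ}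
    (hφ : DifferentiableOn ℂ φ Ω) (n : ℕ) : ∀ (P : Polynomial ℂ) (_ : ∀ k, n ≤ k → P.coeff k = 0)
      (f : ℂ → ℂ) (_ : ∀ z ∈ Ω, iteratedDeriv n φ z = f z),
      Complex.IsExactOn (fun z => P.eval z * f z) Ω := by
  induction n with
  | zero =>
    intro P hP f _
    have : P = 0 := Polynomial.ext fun k => by simpa using hP k (Nat.zero_le k)
    exact ⟨0, fun z _ => by simp [this, hasDerivAt_zero]⟩
  | succ n ih =>
    intro P hP f hf
    obtain ⟨ψ, hψ⟩ := ih P.derivative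
      (fun k hk => by rw [Polynomial.coeff_derivative, hP (k + 1) (by omega), zero_mul])
      (iteratedDeriv n φ) fun z _ => rfl
    refine ⟨fun z => P.eval z * iteratedDeriv n φ z - ψ z, fun z hz => ?_⟩
    have hd : HasDerivAt (iteratedDeriv n φ) (f z) z := by
      rw [← hf z hz, iteratedDeriv_succ]
      have h1 := (hφ.analyticOnNhd hΩ).iterated_deriv n
      rw [← iteratedDeriv_eq_iterate] at h1
      exact (h1 z hz).differentiableAt.hasDerivAt
    refine (((P.hasDerivAt z).mul hd).sub (hψ z hz)).congr_deriv ?_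
    ring

theorem HasPrimitivesOfEveryOrder.isExactOn_eval_mul {Ω : Set ℂ} (hΩ : IsOpen Ω) {f : ℂ → ℂ}
    (hf : HasPrimitivesOfEveryOrder f Ω) (P : Polynomial ℂ) :
    Complex.IsExactOn (fun z => P.eval z * f z) Ω := by
  obtain ⟨φ, hφ, hφf⟩ := hf (P.natDegree + 1) (by omega)
  exact isExactOn_eval_mul_of_iteratedDeriv_eq hΩ hφ _ P
    (fun k hk => Polynomial.coeff_eq_zero_of_natDegree_lt (by omega)) f hφf

theorem exists_hasDerivAt_log_sub {G : Set ℂ} (hG : IsSimplyConnectedDomain G) {z : ℂ}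
    (hz : z ∉ G) : ∃ L : ℂ → ℂ, ∀ w ∈ G, HasDerivAt L (w - z)⁻¹ w := by
  obtain ⟨L, hLc, hL⟩ := Complex.exists_continuousOn_eqOn_exp_comp hG.2 hG.1
    (g := fun w => w - z) (by fun_prop) (by
      rintro ⟨w, hw, h0⟩
      exact hz (sub_eq_zero.1 h0 ▸ hw))
  refine ⟨L, fun w hw => ?_⟩
  have h1 : Complex.exp (L w) = w - z := hL hw
  have hder : HasDerivAt (fun u => Complex.exp u + z) (w - z) (L w) := by
    simpa [h1] using (Complex.hasDerivAt_exp (L w)).add_const z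
  refine hder.of_local_left_inverse (hLc.continuousAt (hG.1.mem_nhds hw))
    (h1 ▸ Complex.exp_ne_zero _) ?_
  filter_upwards [hG.1.mem_nhds hw] with u hu
  have h2 : Complex.exp (L u) = u - z := hL hu
  rw [h2]
  ring

theorem isExactOn_eval_mul_inv_sub {Ω : Set ℂ} {z : ℂ} (hz : z ∉ Ω) {L : ℂ → ℂ}
    (hL : ∀ w ∈ Ω, HasDerivAt L (w - z)⁻¹ w) (P : Polynomial ℂ) :
    Complex.IsExactOn (fun w => P.eval w * (w - z)⁻¹) Ω := by
  -- `P(w)/(w - z) = Q(w) + P(z)/(w - z)`, and `Q` has an entire primitive.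
  obtain ⟨Q, hQ⟩ := Polynomial.X_sub_C_dvd_sub_C_eval (p := P) (a := z)
  obtain ⟨q, hq⟩ := Differentiable.isExactOn_univ (f := fun w => Q.eval w) Q.differentiable
  refine ⟨fun w => q w + P.eval z * L w, fun w hw => ?_⟩
  refine ((hq w (mem_univ w)).add ((hL w hw).const_mul (P.eval z))).congr_deriv ?_
  have h1 : P.eval w - P.eval z = (w - z) * Q.eval w := by
    simpa using congrArg (Polynomial.eval w) hQ
  have h2 : w - z ≠ 0 := sub_ne_zero.2 fun h => hz (h ▸ hw)
  field_simp
  linear_combination -h1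

/-! ### The Cauchy–Riemann operator and the Cauchy transform -/

section Dbar

open MeasureTheory Complex

/-- The Cauchy–Riemann operator `∂ₓ + i ∂ᵧ`. -/
noncomputable def cauchyRiemann (φ : ℂ → ℂ) (z : ℂ) : ℂ := fderiv ℝ φ z 1 + I * fderiv ℝ φ z I

theorem differentiableAt_iff_cauchyRiemann_eq_zero {φ : ℂ → ℂ} {z : ℂ} :
    DifferentiableAt ℂ φ z ↔ DifferentiableAt ℝ φ z ∧ cauchyRiemann φ z = 0 := by
  rw [differentiableAt_complex_iff_differentiableAt_real, cauchyRiemann, smul_eq_mul]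
  refine and_congr_right fun _ => ⟨fun h => ?_, fun h => ?_⟩
  · rw [h, ← mul_assoc, I_mul_I]
    ring
  · linear_combination (-I) * h + fderiv ℝ φ z I * I_mul_I

theorem cauchyRiemann_mul {φ ψ : ℂ → ℂ} {z : ℂ} (hφ : DifferentiableAt ℝ φ z)
    (hψ : DifferentiableAt ℝ ψ z) :
    cauchyRiemann (fun w => φ w * ψ w) z =
      φ z * cauchyRiemann ψ z + cauchyRiemann φ z * ψ z := by
  simp only [cauchyRiemann, fderiv_fun_mul hφ hψ, add_apply,
    smul_apply, smul_eq_mul]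
  ring

theorem cauchyRiemann_sub {φ ψ : ℂ → ℂ} {z : ℂ} (hφ : DifferentiableAt ℝ φ z)
    (hψ : DifferentiableAt ℝ ψ z) :
    cauchyRiemann (fun w => φ w - ψ w) z = cauchyRiemann φ z - cauchyRiemann ψ z := by
  simp only [cauchyRiemann, fderiv_fun_sub hφ hψ, sub_apply]
  ring

theorem locallyIntegrable_inv : LocallyIntegrable (fun z : ℂ => z⁻¹) := by
  rw [locallyIntegrable_iff]
  intro k hk
  obtain ⟨R, hR⟩ := hk.isBounded.exists_norm_le
  have h1 : Integrable (fun z : ℂ => (Iic R).indicator (fun r : ℝ => r⁻¹) ‖z‖) := by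
    rw [integrable_fun_norm_addHaar (volume : Measure ℂ), Complex.finrank_real_complex]
    have h2 : IntegrableOn ((Iic R).indicator fun _ : ℝ => (1 : ℝ)) (Ioi 0) := by
      rw [IntegrableOn, integrable_indicator_iff measurableSet_Iic, IntegrableOn,
        Measure.restrict_restrict measurableSet_Iic, inter_comm, Ioi_inter_Iic]
      exact integrableOn_const (by simp)
    refine h2.congr_fun (fun r hr => ?_) measurableSet_Ioi
    by_cases hrR : r ∈ Iic R
    · simp [indicator_of_mem hrR, (mem_Ioi.1 hr).ne']
    · simp [indicator_of_notMem hrR]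
  refine Integrable.mono' h1.integrableOn measurable_inv.aestronglyMeasurable ?_
  filter_upwards [ae_restrict_mem hk.measurableSet] with z hz
  rw [indicator_of_mem (mem_Iic.2 (hR z hz)), norm_inv]

theorem integrableOn_polarCoord_target {H : ℝ × ℝ → ℂ} (hH : Continuous H) {R : ℝ}
    (hR : ∀ p : ℝ × ℝ, R < p.1 → H p = 0) : IntegrableOn H polarCoord.target := by
  refine IntegrableOn.of_forall_sdiff_eq_zero
    (hH.continuousOn.integrableOn_compact (isCompact_Icc.prod isCompact_Icc) :
      IntegrableOn H (Icc 0 R ×ˢ Icc (-Real.pi) Real.pi))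
    polarCoord.open_target.measurableSet ?_
  rintro p ⟨hp, hp'⟩
  rw [polarCoord_target] at hp
  refine hR p (not_le.1 fun h => hp' ⟨⟨hp.1.le, h⟩, hp.2.1.le, hp.2.2.le⟩)

/-- In polar coordinates the Jacobian cancels the modulus of `z⁻¹`, leaving the radial derivative
`A` plus `I` times the angular derivative over `r`, called `B`. The first integrates to `-φ 0` on
each ray, the second to `0` on each circle. -/
theorem integral_inv_mul_cauchyRiemann {φ : ℂ → ℂ} (hφ : ContDiff ℝ 1 φ)
    (hc : HasCompactSupport φ) :
    ∫ z, z⁻¹ * cauchyRiemann φ z = -(2 * Real.pi * φ 0) := by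
  obtain ⟨R, hR⟩ := hc.isCompact.isBounded.exists_norm_le
  let E : ℝ → ℂ := fun θ => Real.cos θ + Real.sin θ * I
  have hEc : Continuous E := by fun_prop
  have hE1 : ∀ θ, ‖E θ‖ = 1 := fun θ => by
    have : E θ = exp (θ * I) := by simp [E, exp_mul_I]
    rw [this, norm_exp_ofReal_mul_I]
  have hE0 : ∀ θ, E θ ≠ 0 := fun θ h => by simpa [h] using hE1 θ
  have hEd : ∀ θ, HasDerivAt E (I * E θ) θ := fun θ => by
    have h1 := (Real.hasDerivAt_cos θ).ofReal_comp.add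
      ((Real.hasDerivAt_sin θ).ofReal_comp.mul_const I)
    refine h1.congr_deriv ?_
    simp only [E]
    push_cast
    linear_combination (-(Complex.sin θ)) * I_mul_I
  have hD := hφ.continuous_fderiv one_ne_zero
  have hDφ : ∀ z, HasFDerivAt φ (fderiv ℝ φ z) z := fun z =>
    (hφ.differentiable one_ne_zero z).hasFDerivAt
  let A : ℝ × ℝ → ℂ := fun p => fderiv ℝ φ (p.1 * E p.2) (E p.2)
  let B : ℝ × ℝ → ℂ := fun p => fderiv ℝ φ (p.1 * E p.2) (I * E p.2)
  have hAc : Continuous A := by fun_prop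
  have hBc : Continuous B := by fun_prop
  have hzero : ∀ p : ℝ × ℝ, max R 0 < p.1 → fderiv ℝ φ (p.1 * E p.2) = 0 := by
    intro p hp
    refine image_eq_zero_of_notMem_tsupport fun h => ?_
    have := hR _ (tsupport_fderiv_subset ℝ h)
    rw [norm_mul, hE1, mul_one, norm_real, Real.norm_eq_abs] at this
    exact absurd ((le_abs_self _).trans this) (not_le.2 ((le_max_left _ _).trans_lt hp))
  have hAi := integrableOn_polarCoord_target hAc (R := max R 0) fun p hp => by
    simp only [A, hzero p hp, zero_apply]
  have hBi := integrableOn_polarCoord_target hBc (R := max R 0) fun p hp => by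
    simp only [B, hzero p hp, zero_apply]
  have hAint : ∫ p in polarCoord.target, A p = -(2 * Real.pi * φ 0) := by
    rw [polarCoord_target, Measure.volume_eq_prod, ← setIntegral_prod_swap, setIntegral_prod]
    · have hinner : ∀ θ : ℝ, ∫ r in Ioi (0 : ℝ), A (r, θ) = -φ 0 := by
        intro θ
        have hd : ∀ r : ℝ, HasDerivAt (fun r : ℝ => φ (r * E θ)) (A (r, θ)) r := fun r => by
          have h1 : HasDerivAt (fun r : ℝ => (r : ℂ) * E θ) (E θ) r := by
            simpa using (hasDerivAt_id r).ofReal_comp.mul_const (E θ)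
          exact (hDφ _).comp_hasDerivAt r h1
        have h2 : HasCompactSupport fun r : ℝ => φ (r * E θ) := by
          refine HasCompactSupport.of_support_subset_isCompact (isCompact_Icc (a := -R) (b := R)) ?_
          intro r hr
          have := hR _ (subset_tsupport φ hr)
          rw [norm_mul, hE1, mul_one, norm_real, Real.norm_eq_abs] at this
          exact abs_le.1 this
        have h3 : ContDiff ℝ 1 fun r : ℝ => φ (r * E θ) :=
          hφ.comp (ofRealCLM.contDiff.mul contDiff_const)
        have h4 := h2.integral_Ioi_deriv_eq h3 0
        rw [show deriv (fun r : ℝ => φ (r * E θ)) = fun r => A (r, θ) from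
          funext fun r => (hd r).deriv] at h4
        simpa using h4
      simp only [Prod.swap_prod_mk, hinner, setIntegral_const]
      rw [Real.volume_real_Ioo_of_le (by linarith [Real.pi_pos])]
      simp only [real_smul]
      push_cast
      ring
    · have h1 := hAi
      rw [polarCoord_target, Measure.volume_eq_prod] at h1
      rw [IntegrableOn, ← Measure.prod_restrict] at h1 ⊢
      exact h1.swap
  have hBint : ∫ p in polarCoord.target, B p = 0 := by
    have h1 := hBi
    rw [polarCoord_target, Measure.volume_eq_prod] at h1 ⊢
    rw [setIntegral_prod _ h1]
    refine setIntegral_eq_zero_of_forall_eq_zero fun r hr => ?_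
    have hr0 : (r : ℂ) ≠ 0 := ofReal_ne_zero.2 (mem_Ioi.1 hr).ne'
    rw [← integral_Ioc_eq_integral_Ioo, ← intervalIntegral.integral_of_le
      (by linarith [Real.pi_pos])]
    have hd : ∀ θ : ℝ, HasDerivAt (fun θ : ℝ => (r : ℂ)⁻¹ * φ (r * E θ)) (B (r, θ)) θ := fun θ => by
      have h2 := ((hDφ _).comp_hasDerivAt θ ((hEd θ).const_mul (r : ℂ))).const_mul (r : ℂ)⁻¹
      refine h2.congr_deriv ?_
      have h3 : (r : ℂ) * (I * E θ) = r • (I * E θ) := by rw [real_smul]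
      rw [h3, map_smul, real_smul, inv_mul_cancel_left₀ hr0]
    rw [intervalIntegral.integral_eq_sub_of_hasDerivAt (fun θ _ => hd θ)
      (Continuous.intervalIntegrable (by fun_prop) _ _)]
    simp [E]
  rw [← Complex.integral_comp_polarCoord_symm]
  have hcongr : ∀ p ∈ polarCoord.target,
      p.1 • ((Complex.polarCoord.symm p)⁻¹ * cauchyRiemann φ (Complex.polarCoord.symm p)) =
        A p + I * B p := by
    intro p hp
    rw [polarCoord_target] at hp
    have hp0 : (p.1 : ℂ) ≠ 0 := ofReal_ne_zero.2 (mem_Ioi.1 hp.1).ne'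
    rw [Complex.polarCoord_symm_apply]
    change p.1 • (((p.1 : ℂ) * E p.2)⁻¹ * cauchyRiemann φ (p.1 * E p.2)) = _
    set L := fderiv ℝ φ (p.1 * E p.2) with hL
    have e1 : A p = Real.cos p.2 * L 1 + Real.sin p.2 * L I := by
      have : E p.2 = Real.cos p.2 • (1 : ℂ) + Real.sin p.2 • I := by simp [E]
      simp only [A]
      rw [← hL, this, map_add, map_smul, map_smul, real_smul, real_smul]
    have e2 : B p = -Real.sin p.2 * L 1 + Real.cos p.2 * L I := by
      have : I * E p.2 = (-Real.sin p.2) • (1 : ℂ) + Real.cos p.2 • I := by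
        simp only [E, real_smul]
        push_cast
        linear_combination (Complex.sin p.2) * I_mul_I
      simp only [B]
      rw [← hL, this, map_add, map_smul, map_smul, real_smul, real_smul]
      push_cast
      ring
    have e3 : (Real.cos p.2 : ℂ) ^ 2 + (Real.sin p.2 : ℂ) ^ 2 = 1 := by
      exact_mod_cast Real.cos_sq_add_sin_sq p.2
    rw [real_smul, mul_inv, ← mul_assoc, ← mul_assoc, mul_inv_cancel₀ hp0, one_mul,
      inv_mul_eq_iff_eq_mul₀ (hE0 _), e1, e2, cauchyRiemann, ← hL]
    simp only [E]
    linear_combination (-(L 1 + I * L I)) * e3 +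
      (Real.sin p.2 ^ 2 * L 1 - Real.sin p.2 * Real.cos p.2 * L I) * I_mul_I
  rw [setIntegral_congr_fun polarCoord.open_target.measurableSet hcongr,
    integral_add hAi (hBi.const_mul I), hAint, integral_const_mul, hBint]
  ring

open scoped Convolution in
-- The solution is the convolution of `g` with `1/(2πz)`. Derivatives fall on `g`, and the formula
-- at the origin applies to `w ↦ g (z - w)`.
theorem exists_cauchyRiemann_eq {g : ℂ → ℂ} (hg : ContDiff ℝ 1 g) (hc : HasCompactSupport g) :
    ∃ v : ℂ → ℂ, Differentiable ℝ v ∧ (∀ z, cauchyRiemann v z = g z) ∧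
      ∀ z, v z = (2 * Real.pi : ℂ)⁻¹ * ∫ w, (z - w)⁻¹ * g w := by
  let L := ContinuousLinearMap.mul ℝ ℂ
  let κ : ℂ → ℂ := fun z => z⁻¹
  have hder := hc.hasFDerivAt_convolution_right L locallyIntegrable_inv hg
  have hval : ∀ z d, (κ ⋆[L.precompR ℂ, volume] fderiv ℝ g) z d =
      ∫ w, w⁻¹ * fderiv ℝ g (z - w) d := fun z d => by
    rw [convolution_precompR_apply L locallyIntegrable_inv (hc.fderiv ℝ)
      (hg.continuous_fderiv one_ne_zero)]
    rfl
  have hint : ∀ z d, Integrable fun w => w⁻¹ * fderiv ℝ g (z - w) d := fun z d => by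
    have h1 : HasCompactSupport fun a => fderiv ℝ g a d :=
      (hc.fderiv ℝ).comp_left (g := fun T : ℂ →L[ℝ] ℂ => T d) rfl
    have h2 : Continuous fun a => fderiv ℝ g a d := by
      have := hg.continuous_fderiv one_ne_zero
      fun_prop
    exact h1.convolutionExists_right L locallyIntegrable_inv h2 z
  have hpi : (2 * Real.pi : ℂ) ≠ 0 := by
    simp [Real.pi_ne_zero]
  refine ⟨fun z => (2 * Real.pi : ℂ)⁻¹ * (κ ⋆[L, volume] g) z, fun z =>
    ((hder z).differentiableAt).const_mul _, fun z => ?_, fun z => ?_⟩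
  · have h1 : fderiv ℝ (fun z => (2 * Real.pi : ℂ)⁻¹ * (κ ⋆[L, volume] g) z) z =
        (2 * Real.pi : ℂ)⁻¹ • (κ ⋆[L.precompR ℂ, volume] fderiv ℝ g) z :=
      ((hder z).const_mul _).fderiv
    rw [cauchyRiemann, h1]
    simp only [smul_apply, smul_eq_mul, hval]
    let φ : ℂ → ℂ := fun w => g (z - w)
    have hφ : ContDiff ℝ 1 φ := by fun_prop
    have hφc : HasCompactSupport φ := hc.comp_homeomorph (Homeomorph.subLeft z)
    have h2 := integral_inv_mul_cauchyRiemann hφ hφc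
    have h3 : ∀ w, cauchyRiemann φ w = -cauchyRiemann g (z - w) := by
      intro w
      have : HasFDerivAt φ (-fderiv ℝ g (z - w)) w := by
        have h4 := (hg.differentiable one_ne_zero (z - w)).hasFDerivAt.comp w
          ((hasFDerivAt_id w).const_sub z)
        simpa [φ, Function.comp_def] using! h4
      simp only [cauchyRiemann, this.fderiv, neg_apply]
      ring
    simp only [h3, mul_neg, integral_neg, neg_inj] at h2
    have h5 : ∫ w, w⁻¹ * cauchyRiemann g (z - w) =
        (∫ w, w⁻¹ * fderiv ℝ g (z - w) 1) + I * ∫ w, w⁻¹ * fderiv ℝ g (z - w) I := by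
      rw [← integral_const_mul, ← integral_add (hint z 1) ((hint z I).const_mul I)]
      congr 1
      ext w
      rw [cauchyRiemann]
      ring
    rw [h5] at h2
    have h6 : φ 0 = g z := by simp [φ]
    rw [h6] at h2
    rw [mul_left_comm I, ← mul_add, h2, inv_mul_cancel_left₀ hpi]
  · simp only [convolution_def]
    congr 1
    rw [← integral_sub_left_eq_self _ volume z]
    simp [L, κ]

theorem integral_inv_sub_mul_eq_zero {g : ℂ → ℂ} (hg : Continuous g) (hc : HasCompactSupport g)
    (hmom : ∀ n : ℕ, ∫ w, w ^ n * g w = 0) {R : ℝ} (hR : ∀ w ∈ tsupport g, ‖w‖ ≤ R) {z : ℂ}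
    (hz : R < ‖z‖) : ∫ w, (z - w)⁻¹ * g w = 0 := by
  have hz0 : z ≠ 0 ∨ z = 0 := ne_or_eq z 0
  rcases hz0 with hz0 | rfl
  swap
  · have : g = 0 := by
      ext w
      by_contra hw
      have := hR w (subset_tsupport g hw)
      rw [norm_zero] at hz
      linarith [norm_nonneg w]
    simp [this]
  have hznorm : 0 < ‖z‖ := norm_pos_iff.2 hz0
  -- The geometric expansion of the Cauchy kernel at infinity has the moments of `g` as
  -- coefficients.
  have key : HasSum (fun n : ℕ => ∫ w, (z ^ (n + 1))⁻¹ * (w ^ n * g w))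
      (∫ w, (z - w)⁻¹ * g w) := by
    have hsmall : ∀ w, g w ≠ 0 → ‖w‖ / ‖z‖ < 1 ∧ ‖w‖ ≤ R := fun w hw => by
      have := hR w (subset_tsupport g hw)
      exact ⟨(div_lt_one hznorm).2 (this.trans_lt hz), this⟩
    refine hasSum_integral_of_dominated_convergence
      (fun n w => (‖z‖⁻¹ * ‖g w‖) * (max R 0 / ‖z‖) ^ n) (fun n => ?_) (fun n => ?_) ?_ ?_ ?_
    · exact Continuous.aestronglyMeasurable (by fun_prop)
    · refine Filter.Eventually.of_forall fun w => ?_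
      by_cases hw : g w = 0
      · simp [hw]
      · have h1 : ‖w‖ ^ n ≤ (max R 0) ^ n :=
          pow_le_pow_left₀ (norm_nonneg w) ((hsmall w hw).2.trans (le_max_left _ _)) n
        rw [norm_mul, norm_inv, norm_mul, norm_pow, norm_pow, div_pow, pow_succ, mul_inv]
        calc (‖z‖ ^ n)⁻¹ * ‖z‖⁻¹ * (‖w‖ ^ n * ‖g w‖)
            ≤ (‖z‖ ^ n)⁻¹ * ‖z‖⁻¹ * ((max R 0) ^ n * ‖g w‖) := by gcongr
          _ = ‖z‖⁻¹ * ‖g w‖ * ((max R 0) ^ n / ‖z‖ ^ n) := by ring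
    · refine Filter.Eventually.of_forall fun w => ?_
      exact (summable_geometric_of_lt_one (by positivity)
        ((div_lt_one hznorm).2 (max_lt hz hznorm))).mul_left _
    · simp only [tsum_mul_left]
      exact ((hg.norm.integrable_of_hasCompactSupport hc.norm).const_mul _).mul_const _
    · refine Filter.Eventually.of_forall fun w => ?_
      by_cases hw : g w = 0
      · simp [hw, hasSum_zero]
      · have h1 : ‖w / z‖ < 1 := by rw [norm_div]; exact (hsmall w hw).1
        have hzw : z - w ≠ 0 := fun h => by
          rw [← sub_eq_zero.1 h, div_self hz0, norm_one] at h1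
          exact lt_irrefl _ h1
        have h2 := (hasSum_geometric_of_norm_lt_one h1).mul_left (z⁻¹ * g w)
        have e1 : (fun n : ℕ => (z ^ (n + 1))⁻¹ * (w ^ n * g w)) =
            fun n => z⁻¹ * g w * (w / z) ^ n := by
          funext n
          rw [div_pow, pow_succ]
          field_simp
        have e2 : (z - w)⁻¹ * g w = z⁻¹ * g w * (1 - w / z)⁻¹ := by
          rw [one_sub_div hz0, inv_div]
          field_simp
        rw [e1, e2]
        exact h2
  have h0 : ∀ n : ℕ, ∫ w, (z ^ (n + 1))⁻¹ * (w ^ n * g w) = 0 := fun n => by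
    rw [integral_const_mul, hmom, mul_zero]
  simp only [h0] at key
  exact key.unique hasSum_zero

theorem integral_fderiv_apply_eq_zero {h : ℂ → ℂ} (hh : ContDiff ℝ 1 h) (hc : HasCompactSupport h)
    (d : ℂ) : ∫ z, fderiv ℝ h z d = 0 := by
  have hD := hh.continuous_fderiv one_ne_zero
  have h1 : Integrable fun z => fderiv ℝ h z d :=
    Continuous.integrable_of_hasCompactSupport (by fun_prop)
      ((hc.fderiv ℝ).comp_left (g := fun T : ℂ →L[ℝ] ℂ => T d) rfl)
  have h2 := integral_mul_fderiv_eq_neg_fderiv_mul_of_integrable (μ := (volume : Measure ℂ))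
    (f := fun _ => (1 : ℂ)) (g := h) (v := d) (by simp) (by simpa using h1)
    (by simpa using hh.continuous.integrable_of_hasCompactSupport hc)
    (fun z _ => differentiableAt_const _) (fun z _ => hh.differentiable one_ne_zero z)
  simpa using h2

theorem contDiff_mul_of_tsupport_subset {Ω : Set ℂ} (hΩ : IsOpen Ω) {f k : ℂ → ℂ} {n : ℕ∞}
    (hf : DifferentiableOn ℂ f Ω) (hk : ContDiff ℝ n k) (hkΩ : tsupport k ⊆ Ω) :
    ContDiff ℝ n fun z => f z * k z := by
  rw [contDiff_iff_contDiffAt]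
  intro z
  by_cases hz : z ∈ tsupport k
  · have h1 : ContDiffAt ℂ n f z :=
      (hf.contDiffOn hΩ z (hkΩ hz)).contDiffAt (hΩ.mem_nhds (hkΩ hz))
    exact (h1.restrict_scalars ℝ).mul hk.contDiffAt
  · have h1 : (fun w => f w * k w) =ᶠ[nhds z] fun _ => 0 := by
      filter_upwards [(isClosed_tsupport k).isOpen_compl.mem_nhds hz] with w hw
      rw [image_eq_zero_of_notMem_tsupport hw, mul_zero]
    exact contDiffAt_const.congr_of_eventuallyEq h1

/-- With `Ψ' = f`, the integrand is a constant multiple of the density of `d(Ψ dχ) = f dz ∧ dχ`; the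
mixed second derivatives of `χ` cancel. Only `dχ`, not `χ`, is supported in `Ω`, which is enough for
`Ψ dχ` to be smooth with compact support. -/
theorem integral_mul_cauchyRiemann_eq_zero {Ω : Set ℂ} (hΩ : IsOpen Ω) {f χ : ℂ → ℂ}
    (hf : IsExactOn f Ω) (hχ : ContDiff ℝ 2 χ) (hc : HasCompactSupport χ)
    (hχΩ : tsupport (fderiv ℝ χ) ⊆ Ω) : ∫ z, f z * cauchyRiemann χ z = 0 := by
  obtain ⟨Ψ, hΨ⟩ := hf
  have hΨd : DifferentiableOn ℂ Ψ Ω := fun z hz =>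
    (hΨ z hz).differentiableAt.differentiableWithinAt
  have hD1 : ContDiff ℝ 1 (fderiv ℝ χ) := hχ.fderiv_right (by norm_num [one_add_one_eq_two])
  have hk : ∀ d : ℂ, ContDiff ℝ 1 (fun z => fderiv ℝ χ z d) ∧
      tsupport (fun z => fderiv ℝ χ z d) ⊆ Ω ∧
      HasCompactSupport (fun z => Ψ z * fderiv ℝ χ z d) ∧
      (∀ z, fderiv ℝ (fun z => fderiv ℝ χ z d) z = (fderiv ℝ (fderiv ℝ χ) z).flip d) := by
    intro d
    refine ⟨by fun_prop, ?_, ?_, fun z => ?_⟩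
    · exact (tsupport_comp_subset (g := fun T : ℂ →L[ℝ] ℂ => T d) rfl _).trans hχΩ
    · exact ((hc.fderiv ℝ).comp_left (g := fun T : ℂ →L[ℝ] ℂ => T d) rfl).mul_left
    · have h1 := ((hD1.differentiable one_ne_zero z).hasFDerivAt).clm_apply
        (hasFDerivAt_const d z)
      rw [h1.fderiv]
      ext1
      simp
  have hdiv : ∀ d e : ℂ, ∫ z, fderiv ℝ (fun z => Ψ z * fderiv ℝ χ z d) z e = 0 := fun d e =>
    integral_fderiv_apply_eq_zero (contDiff_mul_of_tsupport_subset hΩ (n := 1) hΨd (hk d).1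
      (hk d).2.1) (hk d).2.2.1 e
  have hint : ∀ d e : ℂ, Integrable fun z => fderiv ℝ (fun z => Ψ z * fderiv ℝ χ z d) z e := by
    intro d e
    have h1 := contDiff_mul_of_tsupport_subset hΩ (n := 1) hΨd (hk d).1 (hk d).2.1
    have h2 := h1.continuous_fderiv one_ne_zero
    exact Continuous.integrable_of_hasCompactSupport (by fun_prop)
      (((hk d).2.2.1.fderiv ℝ).comp_left (g := fun T : ℂ →L[ℝ] ℂ => T e) rfl)
  have hpt : ∀ z, f z * cauchyRiemann χ z =
      I * (fderiv ℝ (fun z => Ψ z * fderiv ℝ χ z I) z 1 -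
        fderiv ℝ (fun z => Ψ z * fderiv ℝ χ z 1) z I) := by
    intro z
    by_cases hz : z ∈ tsupport (fderiv ℝ χ)
    · have hzΩ := hχΩ hz
      have hΨr : HasFDerivAt Ψ ((ContinuousLinearMap.toSpanSingleton ℂ (f z)).restrictScalars ℝ) z :=
        (hΨ z hzΩ).hasFDerivAt.restrictScalars ℝ
      have hprod : ∀ d e, fderiv ℝ (fun z => Ψ z * fderiv ℝ χ z d) z e =
          Ψ z * fderiv ℝ (fderiv ℝ χ) z e d + fderiv ℝ χ z d * (e * f z) := by
        intro d e
        rw [fderiv_fun_mul hΨr.differentiableAt ((hk d).1.differentiable one_ne_zero z),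
          (hk d).2.2.2, hΨr.fderiv]
        simp
      have hsymm : fderiv ℝ (fderiv ℝ χ) z 1 I = fderiv ℝ (fderiv ℝ χ) z I 1 :=
        hχ.contDiffAt.isSymmSndFDerivAt (by simp) 1 I
      rw [hprod, hprod, hsymm, cauchyRiemann]
      linear_combination (fderiv ℝ χ z 1 * f z) * I_mul_I
    · have h1 : fderiv ℝ χ z = 0 := image_eq_zero_of_notMem_tsupport hz
      have h2 : ∀ d, fderiv ℝ (fun z => Ψ z * fderiv ℝ χ z d) z = 0 := by
        intro d
        have : (fun z => Ψ z * fderiv ℝ χ z d) =ᶠ[nhds z] fun _ => 0 := by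
          filter_upwards [(isClosed_tsupport _).isOpen_compl.mem_nhds hz] with w hw
          rw [image_eq_zero_of_notMem_tsupport hw]
          simp
        rw [this.fderiv_eq, fderiv_fun_const]
        rfl
      simp [cauchyRiemann, h1, h2]
  simp only [hpt]
  rw [integral_const_mul, integral_sub (hint I 1) (hint 1 I), hdiv, hdiv]
  simp

end Dbar

/-! ### Extension across compact pieces of the complement -/

theorem exists_smooth_cutoff {A W : Set ℂ} (hA : IsCompact A) (hW : IsOpen W) (hAW : A ⊆ W) :
    ∃ χ : ℂ → ℂ, ContDiff ℝ 2 χ ∧ HasCompactSupport χ ∧ tsupport χ ⊆ W ∧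
      ∀ z ∈ A, ∀ᶠ w in nhds z, χ w = 1 := by
  obtain ⟨K, hK, hAK, hKW⟩ := exists_compact_between hA hW hAW
  obtain ⟨u, hu1, hu0, -⟩ := exists_contMDiffMap_one_nhds_of_subset_interior
    (modelWithCornersSelf ℝ ℂ) (n := 2) hA.isClosed hAK
  have hsupp : tsupport (fun z => (u z : ℂ)) ⊆ K := by
    refine closure_minimal (fun z hz => ?_) hK.isClosed
    by_contra hzK
    exact hz (by simp [hu0 z hzK])
  refine ⟨fun z => (u z : ℂ), Complex.ofRealCLM.contDiff.comp u.contMDiff.contDiff,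
    hK.of_isClosed_subset (isClosed_tsupport _) hsupp, hsupp.trans hKW, fun z hz => ?_⟩
  filter_upwards [Filter.eventually_iff.1 (Filter.Eventually.filter_mono (nhds_le_nhdsSet hz) hu1)]
    with w hw
  have : u w = 1 := hw
  simp [this]

theorem IsCompactPiece.exists_extension {Ω A : Set ℂ} (hΩo : IsOpen Ω) (hΩ : IsConnected Ω)
    (hA : IsCompactPiece Ω A) {f : ℂ → ℂ} (hf : DifferentiableOn ℂ f Ω)
    (hex : ∀ P : Polynomial ℂ, Complex.IsExactOn (fun z => P.eval z * f z) Ω) :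
    ∃ F : ℂ → ℂ, DifferentiableOn ℂ F (Ω ∪ A) ∧ EqOn F f Ω := by
  obtain ⟨χ, hχ, hχc, hχW, hχ1⟩ :=
    exists_smooth_cutoff hA.isCompact hA.isOpen_union subset_union_right
  have hχd : Differentiable ℝ χ := hχ.differentiable two_ne_zero
  have hχA : ∀ z ∈ A, ∀ᶠ w in nhds z, fderiv ℝ χ w = 0 := fun z hz => by
    filter_upwards [(hχ1 z hz).eventually_nhds] with w hw
    rw [Filter.EventuallyEq.fderiv_eq (f := fun _ => (1 : ℂ)) hw, fderiv_fun_const]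
    rfl
  have hDΩ : tsupport (fderiv ℝ χ) ⊆ Ω := by
    intro z hz
    refine (hχW (tsupport_fderiv_subset ℝ hz)).resolve_right fun hzA => ?_
    exact notMem_tsupport_iff_eventuallyEq.2 (hχA z hzA) hz
  have hCR0 : ∀ z, z ∉ Ω → cauchyRiemann χ z = 0 := fun z hz => by
    have : fderiv ℝ χ z = 0 := image_eq_zero_of_notMem_tsupport fun h => hz (hDΩ h)
    simp [cauchyRiemann, this]
  have hCRsupp : tsupport (cauchyRiemann χ) ⊆ tsupport (fderiv ℝ χ) := by
    refine closure_mono fun z hz h => hz ?_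
    simp [cauchyRiemann, h]
  have hCRc : HasCompactSupport (cauchyRiemann χ) :=
    (hχc.fderiv ℝ).of_isClosed_subset (isClosed_tsupport _) hCRsupp
  have hCRd : ContDiff ℝ 1 (cauchyRiemann χ) := by
    have h1 : ContDiff ℝ 1 (fderiv ℝ χ) := hχ.fderiv_right (by norm_num [one_add_one_eq_two])
    unfold cauchyRiemann
    fun_prop
  have hg := contDiff_mul_of_tsupport_subset hΩo (n := 1) hf hCRd (hCRsupp.trans hDΩ)
  have hgc : HasCompactSupport fun z => f z * cauchyRiemann χ z := hCRc.mul_left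
  obtain ⟨v, hvd, hvCR, hv⟩ := exists_cauchyRiemann_eq hg hgc
  have hmom : ∀ n : ℕ, ∫ w, w ^ n * (f w * cauchyRiemann χ w) = 0 := fun n => by
    have h1 := integral_mul_cauchyRiemann_eq_zero hΩo (hex (Polynomial.X ^ n)) hχ hχc hDΩ
    simpa [mul_assoc] using h1
  obtain ⟨R, hR⟩ := (hgc.isCompact.union hχc.isCompact).isBounded.exists_norm_le
  have hv0 : ∀ z, R < ‖z‖ → v z = 0 := fun z hz => by
    rw [hv, integral_inv_sub_mul_eq_zero hg.continuous hgc hmom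
      (fun w hw => hR w (Or.inl hw)) hz, mul_zero]
  have hfr : ∀ z ∈ Ω, DifferentiableAt ℝ f z ∧ cauchyRiemann f z = 0 := fun z hz =>
    differentiableAt_iff_cauchyRiemann_eq_zero.1 (hf.differentiableAt (hΩo.mem_nhds hz))
  have hvC : ∀ z, z ∉ Ω → DifferentiableAt ℂ v z := fun z hz =>
    differentiableAt_iff_cauchyRiemann_eq_zero.2
      ⟨hvd z, by rw [hvCR, hCR0 z hz, mul_zero]⟩
  -- On `Ω` the two `∂̄` derivatives cancel; off `Ω ∪ A` the cutoff vanishes locally and only `-v`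
  -- remains.
  let F₂ : ℂ → ℂ := fun z => f z * χ z - v z
  have hF₂Ω : ∀ z ∈ Ω, DifferentiableAt ℂ F₂ z := by
    intro z hz
    obtain ⟨h1, h2⟩ := hfr z hz
    have h3 : DifferentiableAt ℝ (fun w => f w * χ w) z := h1.mul (hχd z)
    refine differentiableAt_iff_cauchyRiemann_eq_zero.2 ⟨h3.sub (hvd z), ?_⟩
    change cauchyRiemann (fun w => f w * χ w - v w) z = 0
    rw [cauchyRiemann_sub h3 (hvd z), cauchyRiemann_mul h1 (hχd z), h2, hvCR]
    ring
  have hF₂ : DifferentiableOn ℂ F₂ Aᶜ := by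
    intro z hz
    refine DifferentiableAt.differentiableWithinAt ?_
    by_cases hzΩ : z ∈ Ω
    · exact hF₂Ω z hzΩ
    · have hzχ : z ∉ tsupport χ := fun h => (hχW h).elim hzΩ hz
      refine (hvC z hzΩ).neg.congr_of_eventuallyEq ?_
      filter_upwards [(isClosed_tsupport χ).isOpen_compl.mem_nhds hzχ] with w hw
      simp [F₂, image_eq_zero_of_notMem_tsupport hw]
  have hAo : IsOpen Aᶜ := hA.isCompact.isClosed.isOpen_compl
  have hfar : ∀ z : ℂ, R < ‖z‖ → F₂ z = 0 := fun z hz => by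
    have : χ z = 0 := image_eq_zero_of_notMem_tsupport fun h =>
      absurd (hR z (Or.inr h)) (not_le.2 hz)
    simp [F₂, this, hv0 z hz]
  obtain ⟨M, hM⟩ := hA.isCompact.isBounded.exists_norm_le
  obtain ⟨z₁, hz₁⟩ : ∃ z : ℂ, max R M < ‖z‖ :=
    ⟨((|max R M| + 1 : ℝ) : ℂ), by
      rw [Complex.norm_real, Real.norm_of_nonneg (by positivity)]
      linarith [le_abs_self (max R M)]⟩
  -- Identity theorem: `Aᶜ` is connected and contains points near which `F₂` vanishes.
  have hzero : EqOn F₂ 0 Aᶜ := by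
    refine (hF₂.analyticOnNhd hAo).eqOn_zero_of_preconnected_of_eventuallyEq_zero
      (hA.isPreconnected_compl hΩ) (z₀ := z₁)
      (fun h => absurd (hM z₁ h) (not_le.2 ((le_max_right _ _).trans_lt hz₁))) ?_
    have : {z : ℂ | R < ‖z‖} ∈ nhds z₁ :=
      (isOpen_lt continuous_const continuous_norm).mem_nhds ((le_max_left _ _).trans_lt hz₁)
    filter_upwards [this] with z hz using hfar z hz
  have hFf : ∀ z ∈ Ω, f z - F₂ z = f z := fun z hz => by
    have : F₂ z = 0 := hzero fun h => hA.subset_compl h hz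
    rw [this, sub_zero]
  have hfv : ∀ z ∈ A, ∀ᶠ w in nhds z, f w - F₂ w = v w := fun z hz => by
    filter_upwards [hχ1 z hz] with w hw
    simp [F₂, hw]
  -- Near `A`, where `χ = 1`, the arbitrary values of `f` on `A` cancel and `v` is left.
  refine ⟨fun z => f z - F₂ z, ?_, hFf⟩
  rintro z (hz | hz)
  · exact ((hf.differentiableAt (hΩo.mem_nhds hz)).sub (hF₂Ω z hz)).differentiableWithinAt
  · exact ((hvC z (hA.subset_compl hz)).congr_of_eventuallyEq (hfv z hz)).differentiableWithinAt

theorem exists_extension_complComponentOfInfinity {Ω : Set ℂ} (hΩ : IsComplexDomain Ω) {f : ℂ → ℂ}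
    (hf : DifferentiableOn ℂ f Ω)
    (hex : ∀ P : Polynomial ℂ, Complex.IsExactOn (fun z => P.eval z * f z) Ω) :
    HasHolomorphicExtension f Ω (complComponentOfInfinity Ω) := by
  classical
  have hext : ∀ A, IsCompactPiece Ω A →
      ∃ F : ℂ → ℂ, DifferentiableOn ℂ F (Ω ∪ A) ∧ EqOn F f Ω := fun A hA =>
    hA.exists_extension hΩ.1 hΩ.2 hf hex
  choose! E hEd hEf using hext
  -- `A ∩ A'` is again a piece, so the overlap is connected and the identity theorem applies from
  -- `Ω`.
  have huniq : ∀ A, IsCompactPiece Ω A → ∀ A', IsCompactPiece Ω A' → ∀ z ∈ Ω ∪ (A ∩ A'),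
      E A z = E A' z := by
    intro A hA A' hA' z hz
    obtain ⟨z₀, hz₀⟩ := hΩ.2.nonempty
    have hAA := hA.inter hA'
    have h1 := ((hEd A hA).mono (union_subset_union_right Ω inter_subset_left)).analyticOnNhd
      hAA.isOpen_union
    have h2 := ((hEd A' hA').mono (union_subset_union_right Ω inter_subset_right)).analyticOnNhd
      hAA.isOpen_union
    refine h1.eqOn_of_preconnected_of_eventuallyEq h2 (hAA.isPreconnected_union hΩ.2)
      (Or.inl hz₀) ?_ hz
    filter_upwards [hΩ.1.mem_nhds hz₀] with w hw
    rw [hEf A hA hw, hEf A' hA' hw]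
  have hcover : ∀ z ∈ complComponentOfInfinity Ω, ∃ A, IsCompactPiece Ω A ∧ z ∈ Ω ∪ A := by
    intro z hz
    rcases (mem_complComponentOfInfinity_iff hΩ.1).1 hz with h | ⟨A, hA, h⟩
    · exact ⟨∅, IsCompactPiece.empty hΩ.1, Or.inl h⟩
    · exact ⟨A, hA, Or.inr h⟩
  choose! C hC hzC using hcover
  have hsub := subset_complComponentOfInfinity Ω
  have hmem : ∀ A, IsCompactPiece Ω A → ∀ z ∈ Ω ∪ A, z ∈ complComponentOfInfinity Ω := by
    rintro A hA z (hz | hz)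
    · exact hsub hz
    · exact (mem_complComponentOfInfinity_iff hΩ.1).2 (Or.inr ⟨A, hA, hz⟩)
  have hglue : ∀ A, IsCompactPiece Ω A → ∀ z ∈ Ω ∪ A, E (C z) z = E A z := by
    intro A hA z hz
    refine huniq _ (hC z (hmem A hA z hz)) A hA z ?_
    rcases hz with hz | hz
    · exact Or.inl hz
    · exact (hzC z (hmem A hA z (Or.inr hz))).imp_right fun h => ⟨h, hz⟩
  refine ⟨fun z => E (C z) z, fun z hz => ?_, fun z hz => hEf _ (hC z (hsub hz)) hz⟩
  have hA := hC z hz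
  have hzA := hzC z hz
  have hnhds := hA.isOpen_union.mem_nhds hzA
  refine DifferentiableAt.differentiableWithinAt
    (((hEd _ hA).differentiableAt hnhds).congr_of_eventuallyEq ?_)
  filter_upwards [hnhds] with w hw using hglue _ hA w hw

/-! ### Minimality of the envelope and the equivalences -/

theorem isSimplyConnectedDomain_complComponentOfInfinity {Ω : Set ℂ} (hΩ : IsComplexDomain Ω) :
    IsSimplyConnectedDomain (complComponentOfInfinity Ω) :=
  ⟨isOpen_complComponentOfInfinity hΩ.1,
    isSimplyConnected_of_no_compactPiece (isOpen_complComponentOfInfinity hΩ.1)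
      (isConnected_complComponentOfInfinity hΩ)
      fun _ hE => hE.eq_empty_of_complComponentOfInfinity⟩

theorem complComponentOfInfinity_subset {Ω G : Set ℂ} (hΩ : IsComplexDomain Ω)
    (hG : IsSimplyConnectedDomain G) (hΩG : Ω ⊆ G) : complComponentOfInfinity Ω ⊆ G := by
  intro z hz
  by_contra hzG
  have hzΩ : z ∉ Ω := fun h => hzG (hΩG h)
  obtain ⟨L, hL⟩ := exists_hasDerivAt_log_sub hG hzG
  have hd : DifferentiableOn ℂ (fun w => (w - z)⁻¹) Ω := fun w hw =>
    ((differentiableAt_id.sub_const z).inv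
      (sub_ne_zero.2 fun h => hzΩ (h ▸ hw))).differentiableWithinAt
  obtain ⟨F, hF, hFf⟩ := exists_extension_complComponentOfInfinity hΩ hd
    (isExactOn_eval_mul_inv_sub hzΩ fun w hw => hL w (hΩG hw))
  obtain ⟨z₀, hz₀⟩ := hΩ.2.nonempty
  have hU := isOpen_complComponentOfInfinity hΩ.1
  have h1 : DifferentiableOn ℂ (fun w => (w - z) * F w) (complComponentOfInfinity Ω) := by
    fun_prop
  -- This identity spreads from `Ω` to the whole envelope and reads `0 = 1` at `z`.
  have h2 : EqOn (fun w => (w - z) * F w) (fun _ => 1) (complComponentOfInfinity Ω) := by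
    refine (h1.analyticOnNhd hU).eqOn_of_preconnected_of_eventuallyEq analyticOnNhd_const
      (isConnected_complComponentOfInfinity hΩ).isPreconnected
      (subset_complComponentOfInfinity Ω hz₀) ?_
    filter_upwards [hΩ.1.mem_nhds hz₀] with w hw
    rw [hFf w hw, mul_inv_cancel₀ (sub_ne_zero.2 fun h : w = z => hzΩ (h ▸ hw))]
  have h3 := h2 hz
  simp at h3

theorem simplyConnectedEnvelope_eq {Ω : Set ℂ} (hΩ : IsComplexDomain Ω) :
    simplyConnectedEnvelope Ω = complComponentOfInfinity Ω :=
  Subset.antisymm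
    (sInter_subset_of_mem ⟨isSimplyConnectedDomain_complComponentOfInfinity hΩ,
      subset_complComponentOfInfinity Ω⟩)
    (subset_sInter fun _ hG => complComponentOfInfinity_subset hΩ hG.1 hG.2)

theorem theorem3 (Ω : Set ℂ) (hΩ : IsComplexDomain Ω) :
    (simplyConnectedEnvelope Ω = complComponentOfInfinity Ω ∧
      Ω ⊆ simplyConnectedEnvelope Ω ∧
      IsSimplyConnectedDomain (simplyConnectedEnvelope Ω)) ∧
    ∀ f : ℂ → ℂ, DifferentiableOn ℂ f Ω →
      List.TFAE [
        HasPrimitivesOfEveryOrder f Ω,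
        ∀ (γ : ClosedPolygonalLine Ω) (P : Polynomial ℂ),
          γ.integral (fun z => P.eval z * f z) = 0,
        HasHolomorphicExtension f Ω (simplyConnectedEnvelope Ω),
        HasHolomorphicExtension f Ω (complComponentOfInfinity Ω)] := by
  rw [simplyConnectedEnvelope_eq hΩ]
  have hsub := subset_complComponentOfInfinity Ω
  refine ⟨⟨rfl, hsub, isSimplyConnectedDomain_complComponentOfInfinity hΩ⟩, fun f hf => ?_⟩
  tfae_have 1 → 2 := fun h γ P => γ.integral_eq_zero_of_isExactOn hΩ.1 (h.isExactOn_eval_mul hΩ.1 P)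
  tfae_have 2 → 3 := fun h => exists_extension_complComponentOfInfinity hΩ hf fun P =>
    isExactOn_of_integral_eq_zero hΩ.1 hΩ.2 (P.differentiable.differentiableOn.mul hf)
      fun γ => h γ P
  tfae_have 3 → 4 := id
  tfae_have 4 → 1 := by
    rintro ⟨F, hF, hFf⟩ n -
    have hU := isOpen_complComponentOfInfinity hΩ.1
    obtain ⟨φ, hφ, hφF⟩ := exists_iteratedDeriv_eq_of_isExactOn hU
      (fun G hG => isExactOn_of_no_compactPiece hU (isConnected_complComponentOfInfinity hΩ)
        (fun _ hE => hE.eq_empty_of_complComponentOfInfinity) hG) n F hF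
    exact ⟨φ, hφ.mono hsub, fun z hz => (hφF z (hsub hz)).trans (hFf z hz)⟩
  tfae_finish
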